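/- There is a universal constant $K>0$ with the following property. Let $d_x\ge 0$ be an integer and let $\sigma_w\ge 0$, $B$, $C>0$ and $L_\star<1$ be real numbers. Then there is $T_0\in\mathbb N$, depending only on $(d_x,\sigma_w,B,C,L_\star)$, such that for all $T\ge T_0$ the following holds. Let $\mathsf X\subset\mathbb R^{d_x}$ satisfy $\sup_{x\in\mathsf X}\|x\|_2\le B$, let $\phi:\mathbb R^{d_x}\to\mathbb R^{d_x}$ be $1$-Lipschitz with respect to $\|\cdot\|_2$, let $A_\star\in\mathbb R^{d_x\times d_x}$ satisfy $\sigma_{\max}(A_\star)\le L_\star$, and let $$\mathbb F^\phi=\{f\in C(\mathsf X\to\mathsf X):\ f(\cdot)=\phi(A\,\cdot\,)\text{ for some }A\in\mathbb R^{d_x\times d_x}\text{ with }\|A\|_F=\sqrt{\operatorname{tr}A^\top A}\le C\}.$$ Assume that $f_\star=\phi(A_\star\,\cdot\,)$, restricted to $\mathsf X$, belongs to $\mathbb F^\phi$. Let $x_0,\dots,x_T$ be an $\mathsf X$-valued trajectory of $$x_{t+1}=\phi(A_\star x_t)+w_t,\qquad t=0,\dots,T-1,$$ and let $(\mathcal F_t)_{t\ge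 -1}$ be a filtration such that $x_t$ is $\mathcal F_{t-1}$-measurable, $w_t$ is $\mathcal F_t$-measurable and integrable, $\mathbf E[w_t\mid\mathcal F_{t-1}]=0$, $w_t$ is conditionally $\sigma_w^2$-subgaussian given $\mathcal F_{t-1}$ (that is, $\mathbf E[e^{\lambda\langle w_t,s\rangle}\mid\mathcal F_{t-1}]\le e^{\lambda^2\sigma_w^2/2}$ almost surely for all $\lambda\in\mathbb R$ and all unit vectors $s$), and $w_t$ is independent of $\mathcal F_{t-1}$. Let $\hat f$ be a (measurable) least squares estimator over $\mathbb F^\phi$, $$\hat f\in\operatorname*{argmin}_{f\in\mathbb F^\phi}\ \frac1T\sum_{t=0}^{T-1}\|x_{t+1}-f(x_t)\|_2^2 ,$$ and let $\xi$ be distributed according to the uniform mixture of the laws of $x_0,\dots,x_{T-1}$, independently of all other randomness. Then $\|\hat f(\xi)-\phi(A_\star\xi)\|_2$ is integrable and $$\mathbf E\,\|\hat f(\xi)-\phi(A_\star\xi)\|_2\le K\left(\sqrt{\frac{\sigma_w^2}{T}\,d_x^2\log\bigl(1+2\sigma_w\sqrt{d_x}\,BCT^2\bigr)}+\sqrt{\frac{B^2}{(1-L_\star)^2T}\,d_x^2\log(1+2BCT)}\right).$$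 -/

import Mathlib

open MeasureTheory ProbabilityTheory

noncomputable section

/-- The Frobenius norm `√(tr AᵀA)` of a real square matrix. -/
def frobNorm {d : ℕ} (A : Matrix (Fin d) (Fin d) ℝ) : ℝ :=
  Real.sqrt (Matrix.trace (A.transpose * A))

/-- The action `x ↦ A x` of a matrix on Euclidean space. Its operator norm is the largest
singular value of `A`. -/
abbrev matAct {d : ℕ} (A : Matrix (Fin d) (Fin d) ℝ) :
    EuclideanSpace ℝ (Fin d) →L[ℝ] EuclideanSpace ℝ (Fin d) :=
  Matrix.toEuclideanCLM (𝕜 := ℝ) A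

/-- The hypothesis class of continuous maps `X → X` of the form `x ↦ φ (A x)`, where `A` has
Frobenius norm at most `C`. -/
def glmClass {d : ℕ} (X : Set (EuclideanSpace ℝ (Fin d)))
    (φ : EuclideanSpace ℝ (Fin d) → EuclideanSpace ℝ (Fin d)) (C : ℝ) : Set C(X, X) :=
  {f | ∃ A : Matrix (Fin d) (Fin d) ℝ, frobNorm A ≤ C ∧
    ∀ x : X, (f x : EuclideanSpace ℝ (Fin d)) = φ (matAct A x)}

/-- `W` is conditionally `σ²`-subgaussian given the σ-algebra `m`: for every unit vector `s` and
every real `l`, `E[exp (l ⟨W - E[W | m], s⟩) | m] ≤ exp (l² σ² / 2)` almost surely. -/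
def CondSubgaussian {Ω : Type*} {mΩ : MeasurableSpace Ω} (P : Measure Ω) (m : MeasurableSpace Ω)
    {d : ℕ} (σ : ℝ) (W : Ω → EuclideanSpace ℝ (Fin d)) : Prop :=
  ∀ s : EuclideanSpace ℝ (Fin d), ‖s‖ = 1 → ∀ l : ℝ,
    Integrable (fun ω => Real.exp (l * inner ℝ (W ω - (P[W | m]) ω) s)) P ∧
    ∀ᵐ ω ∂P, (P[fun ω' => Real.exp (l * inner ℝ (W ω' - (P[W | m]) ω') s) | m]) ω
      ≤ Real.exp (l ^ 2 * σ ^ 2 / 2)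

/-- A trajectory `x_0, …, x_T` in `X` of the generalized linear model
`x_{t+1} = φ (A x_t) + w_t`, driven by `σ²`-subgaussian martingale difference noise which is
independent of the past.

The σ-algebra `ℱ t` is the information available before `w_t` is drawn, so `x_t` is
`ℱ t`-measurable and `w_t` is `ℱ (t + 1)`-measurable. -/
structure IsGLMTrajectory {Ω : Type*} {mΩ : MeasurableSpace Ω} (P : Measure Ω)
    {d : ℕ} (X : Set (EuclideanSpace ℝ (Fin d)))
    (φ : EuclideanSpace ℝ (Fin d) → EuclideanSpace ℝ (Fin d))
    (A : Matrix (Fin d) (Fin d) ℝ) (σ : ℝ) (T : ℕ) (ℱ : Filtration ℕ mΩ)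
    (x : ℕ → Ω → X) (w : ℕ → Ω → EuclideanSpace ℝ (Fin d)) : Prop where
  measurable_state : ∀ t ≤ T, Measurable[ℱ t] (x t)
  measurable_noise : ∀ t < T, Measurable[ℱ (t + 1)] (w t)
  integrable_noise : ∀ t < T, Integrable (w t) P
  condExp_noise : ∀ t < T, P[w t | ℱ t] =ᵐ[P] 0
  subgaussian_noise : ∀ t < T, CondSubgaussian P (ℱ t) σ (w t)
  indep_noise : ∀ t < T, Indep (MeasurableSpace.comap (w t) inferInstance) (ℱ t) P
  dynamics : ∀ t < T, ∀ ω, (x (t + 1) ω : EuclideanSpace ℝ (Fin d)) = φ (matAct A (x t ω)) + w t ω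

/-- The empirical squared loss `(1/T) ∑_{t<T} ‖x_{t+1} - f (x_t)‖²` of a candidate `f`
on a trajectory `x_0, …, x_T`. -/
def empiricalLoss {d : ℕ} {X : Set (EuclideanSpace ℝ (Fin d))} (T : ℕ) (x : ℕ → X)
    (f : C(X, X)) : ℝ :=
  (1 / (T : ℝ)) * ∑ t ∈ Finset.range T,
    ‖(x (t + 1) : EuclideanSpace ℝ (Fin d)) - (f (x t) : EuclideanSpace ℝ (Fin d))‖ ^ 2

/-- `fhat` is a least squares estimator over the class `F`: it is a random element of `F` which,
for each realization of the trajectory, minimizes the empirical loss over `F`. -/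
structure IsLSE {Ω : Type*} [MeasurableSpace Ω] {d : ℕ} {X : Set (EuclideanSpace ℝ (Fin d))}
    (T : ℕ) (x : ℕ → Ω → X) (F : Set C(X, X)) (fhat : Ω → C(X, X)) : Prop where
  measurable_eval : ∀ z : X, Measurable fun ω => fhat ω z
  mem : ∀ ω, fhat ω ∈ F
  isMin : ∀ ω, ∀ f ∈ F,
    empiricalLoss T (fun t => x t ω) (fhat ω) ≤ empiricalLoss T (fun t => x t ω) f

/-- The uniform mixture of the laws of `x_0, …, x_{T-1}`, which is the law of the fresh
sample `ξ`. -/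
def mixtureLaw {Ω : Type*} [MeasurableSpace Ω] (P : Measure Ω) {S : Type*} [MeasurableSpace S]
    (T : ℕ) (x : ℕ → Ω → S) : Measure S :=
  (T : ENNReal)⁻¹ • ∑ t ∈ Finset.range T, P.map (x t)

end

/-! Since `fstar` maps `X` to itself, both `x (t + 1)` and `φ (A x_t)` lie in the ball of radius
`B`, so the noise is bounded by `2B`. This makes the second summand alone, `R = √(B² d² log(1 +
2BCT) / ((1 - L)² T))`, a bound of the right order for large `T`; the other summand is nonnegative.

Training error: for a fixed candidate, Hoeffding's lemma gives the offset process `∑ (4⟨w, g⟩ -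
‖g‖²/2)` exponential moment at most one (`lintegral_exp_offset_le_one`). A union over a matrix grid
of mesh `2C/T`, which has `(T+1)^(d²)` points, and the basic inequality of least squares
(`sum_norm_sq_le_offset`) bound the squared training error by order `B² d² log T`.

From training to population error: the recursion contracts by `L`, so additive functionals of the
trajectory concentrate around their means, by martingale differences of a value function
(`lintegral_exp_sum_sub_integral_le`). Applied directly on the fine grid this would put a factor `dC
+ 1` in the rate. Instead each fine grid point is split into a point of a fixed coarse grid plus an
increment. The increment is uniformly small, and interpolating between its size and its Lipschitz
constant brings its fluctuation scale down to `2B/(1-L)`. The coarse part has bad constants but a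
union bound independent of `T`, so it is absorbed once `T` is large.

All suprema are dominated by one integrable `G` valid for every matrix at once
(`exists_error_majorant`), so no measurable choice of the fitted matrix is needed. -/

noncomputable section

/-! ### Independence, exponential moments and maxima. -/

/-- Joint expectations of independent variables, as iterated integrals. -/
theorem lintegral_indep {Ω S W : Type*} {mΩ : MeasurableSpace Ω} {P : Measure Ω}
    [IsProbabilityMeasure P] [MeasurableSpace S] [MeasurableSpace W] {x : Ω → S} {w : Ω → W}
    (hx : Measurable x) (hw : Measurable w) (h : IndepFun x w P)
    {Φ : S → W → ENNReal} (hΦ : Measurable (Function.uncurry Φ)) :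
    ∫⁻ ω, Φ (x ω) (w ω) ∂P = ∫⁻ ω, ∫⁻ ω', Φ (x ω) (w ω') ∂P ∂P := by
  have hprod := (indepFun_iff_map_prod_eq_prod_map_map hx.aemeasurable hw.aemeasurable).1 h
  have h1 : ∫⁻ ω, Φ (x ω) (w ω) ∂P
      = ∫⁻ p, Function.uncurry Φ p ∂(P.map fun ω => (x ω, w ω)) := by
    rw [lintegral_map hΦ (hx.prodMk hw)]; rfl
  rw [h1, hprod, lintegral_prod _ hΦ.aemeasurable, lintegral_map hΦ.lintegral_prod_right' hx]
  refine lintegral_congr fun ω => ?_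
  exact lintegral_map (hΦ.comp measurable_prodMk_left) hw

theorem integral_indep {Ω S W : Type*} {mΩ : MeasurableSpace Ω} {P : Measure Ω}
    [IsProbabilityMeasure P] [MeasurableSpace S] [MeasurableSpace W] {x : Ω → S} {w : Ω → W}
    (hx : Measurable x) (hw : Measurable w) (h : IndepFun x w P)
    {Φ : S → W → ℝ} (hΦ : Measurable (Function.uncurry Φ)) {c : ℝ} (hc : ∀ z v, |Φ z v| ≤ c) :
    ∫ ω, Φ (x ω) (w ω) ∂P = ∫ ω, ∫ ω', Φ (x ω) (w ω') ∂P ∂P := by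
  have hprod := (indepFun_iff_map_prod_eq_prod_map_map hx.aemeasurable hw.aemeasurable).1 h
  have := Measure.isProbabilityMeasure_map (μ := P) hx.aemeasurable
  have := Measure.isProbabilityMeasure_map (μ := P) hw.aemeasurable
  have h1 : ∫ ω, Φ (x ω) (w ω) ∂P
      = ∫ p, Function.uncurry Φ p ∂(P.map fun ω => (x ω, w ω)) := by
    rw [integral_map (hx.prodMk hw).aemeasurable hΦ.aestronglyMeasurable]; rfl
  have hint : Integrable (Function.uncurry Φ) ((P.map x).prod (P.map w)) :=
    Integrable.of_bound hΦ.aestronglyMeasurable c (ae_of_all _ fun p => hc p.1 p.2)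
  rw [h1, hprod, integral_prod _ hint, integral_map hx.aemeasurable
    hΦ.stronglyMeasurable.integral_prod_right'.aestronglyMeasurable]
  refine integral_congr_ae (ae_of_all _ fun ω => ?_)
  exact integral_map hw.aemeasurable (hΦ.comp measurable_prodMk_left).aestronglyMeasurable

/-- A product of nonnegative factors, each of conditional mean at most one, has mean at most
one. -/
theorem lintegral_prod_le_one {Ω S W : Type*} {mΩ : MeasurableSpace Ω} {P : Measure Ω}
    [IsProbabilityMeasure P] [MeasurableSpace S] [MeasurableSpace W] (ℱ : Filtration ℕ mΩ)
    {x : ℕ → Ω → S} {w : ℕ → Ω → W} {T : ℕ}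
    (hx : ∀ t < T, Measurable[ℱ t] (x t)) (hw : ∀ t < T, Measurable[ℱ (t + 1)] (w t))
    (hind : ∀ t < T, Indep (MeasurableSpace.comap (w t) inferInstance) (ℱ t) P)
    {Φ : ℕ → S → W → ENNReal} (hΦ : ∀ t, Measurable (Function.uncurry (Φ t)))
    (h1 : ∀ t < T, ∀ z, ∫⁻ ω, Φ t z (w t ω) ∂P ≤ 1) :
    ∫⁻ ω, ∏ t ∈ Finset.range T, Φ t (x t ω) (w t ω) ∂P ≤ 1 := by
  suffices H : ∀ n ≤ T, (Measurable[ℱ n] fun ω => ∏ t ∈ Finset.range n, Φ t (x t ω) (w t ω)) ∧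
      ∫⁻ ω, ∏ t ∈ Finset.range n, Φ t (x t ω) (w t ω) ∂P ≤ 1 from (H T le_rfl).2
  intro n
  induction n with
  | zero => intro _; simp
  | succ n ih =>
    intro hn
    obtain ⟨hm, hle⟩ := ih (by omega)
    have hn' : n < T := by omega
    simp only [Finset.prod_range_succ]
    refine ⟨?_, ?_⟩
    · refine Measurable.mul (hm.mono (ℱ.mono (by omega)) le_rfl) ?_
      exact (hΦ n).comp (Measurable.prodMk ((hx n hn').mono (ℱ.mono (by omega)) le_rfl) (hw n hn'))
    -- The past product and the current state are known before `w n` is drawn, so `w n` is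
    -- independent of the pair and can be integrated out first.
    · have hpair : Measurable[ℱ n]
          fun ω => (∏ t ∈ Finset.range n, Φ t (x t ω) (w t ω), x n ω) :=
        Measurable.prodMk hm (hx n hn')
      have hI : IndepFun (fun ω => (∏ t ∈ Finset.range n, Φ t (x t ω) (w t ω), x n ω)) (w n) P := by
        rw [IndepFun_iff_Indep]
        exact (indep_of_indep_of_le_right (hind n hn') hpair.comap_le).symm
      have hmeas : Measurable (Function.uncurry fun (p : ENNReal × S) v => p.1 * Φ n p.2 v) := by
        refine Measurable.mul (by fun_prop) ?_
        exact (hΦ n).comp (f := fun q : (ENNReal × S) × W => (q.1.2, q.2)) (by fun_prop)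
      have e := lintegral_indep (hpair.mono (ℱ.le n) le_rfl) ((hw n hn').mono (ℱ.le _) le_rfl) hI
        (Φ := fun p v => p.1 * Φ n p.2 v) hmeas
      simp only at e
      rw [e]
      refine le_trans (lintegral_mono fun ω => ?_) hle
      have hmm : Measurable fun ω' => Φ n (x n ω) (w n ω') :=
        (hΦ n).comp (Measurable.prodMk measurable_const ((hw n hn').mono (ℱ.le _) le_rfl))
      rw [lintegral_const_mul _ hmm]
      exact (mul_le_mul_right (h1 n hn' _) _).trans (by simp)

/-- Finitely many variables with a common bound on their exponential moments have an integrable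
majorant of small mean. -/
theorem exists_majorant {Ω ι : Type*} {mΩ : MeasurableSpace Ω} {P : Measure Ω}
    [IsProbabilityMeasure P] [Fintype ι] [Nonempty ι] {Z : ι → Ω → ℝ} {l v : ℝ} (hl : 0 < l)
    (hZ : ∀ i, Measurable (Z i))
    (h : ∀ i, ∫⁻ ω, ENNReal.ofReal (Real.exp (l * Z i ω)) ∂P ≤ ENNReal.ofReal (Real.exp v)) :
    ∃ G : Ω → ℝ, Integrable G P ∧ (∀ i ω, Z i ω ≤ G ω) ∧
      ∫ ω, G ω ∂P ≤ (Real.log (Fintype.card ι) + v) / l := by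
  set N : ℝ := (Fintype.card ι : ℝ) with hN
  have hNpos : 0 < N := by rw [hN]; exact_mod_cast Fintype.card_pos
  have hint : ∀ i, Integrable (fun ω => Real.exp (l * Z i ω)) P := fun i => by
    have hmeas : Measurable fun ω => Real.exp (l * Z i ω) :=
      Real.measurable_exp.comp ((hZ i).const_mul l)
    refine ⟨hmeas.aestronglyMeasurable, ?_⟩
    rw [hasFiniteIntegral_iff_ofReal (ae_of_all _ fun ω => (Real.exp_pos _).le)]
    exact (h i).trans_lt ENNReal.ofReal_lt_top
  have hbd : ∀ i, ∫ ω, Real.exp (l * Z i ω) ∂P ≤ Real.exp v := fun i => by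
    rw [integral_eq_lintegral_of_nonneg_ae (ae_of_all _ fun ω => (Real.exp_pos _).le)
      (hint i).aestronglyMeasurable]
    exact ENNReal.toReal_le_of_le_ofReal (Real.exp_pos _).le (h i)
  have hsumint : Integrable (fun ω => ∑ i, Real.exp (l * Z i ω)) P :=
    integrable_finsetSum _ fun i _ => hint i
  -- The tangent to the logarithm at `N exp v` replaces log-sum-exp. The last quotient has mean at
  -- most one, which cancels the `-1`.
  refine ⟨fun ω => (Real.log N + v - 1 + (∑ i, Real.exp (l * Z i ω)) / (N * Real.exp v)) / l,
    ((integrable_const _).add (hsumint.div_const _)).div_const _, fun i ω => ?_, ?_⟩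
  · rw [le_div_iff₀ hl]
    have h1 : Real.exp (l * Z i ω) ≤ ∑ i, Real.exp (l * Z i ω) :=
      Finset.single_le_sum (f := fun i => Real.exp (l * Z i ω))
        (fun _ _ => (Real.exp_pos _).le) (Finset.mem_univ i)
    have h2 : Real.exp (l * Z i ω - (Real.log N + v)) = Real.exp (l * Z i ω) / (N * Real.exp v) := by
      rw [Real.exp_sub, Real.exp_add, Real.exp_log hNpos]
    have h3 := Real.add_one_le_exp (l * Z i ω - (Real.log N + v))
    rw [h2] at h3
    have h4 : Real.exp (l * Z i ω) / (N * Real.exp v)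
        ≤ (∑ i, Real.exp (l * Z i ω)) / (N * Real.exp v) := by gcongr
    linarith
  · rw [integral_div, integral_add (integrable_const _) (hsumint.div_const _), integral_div,
      integral_finsetSum _ fun i _ => hint i]
    simp only [integral_const, probReal_univ, smul_eq_mul, one_mul]
    refine div_le_div_of_nonneg_right ?_ hl.le
    have h5 : ∑ i, ∫ ω, Real.exp (l * Z i ω) ∂P ≤ N * Real.exp v := by
      refine (Finset.sum_le_sum fun i _ => hbd i).trans ?_
      simp [hN]
    have := div_le_one_of_le₀ h5 (by positivity)
    linarith

/-- Hoeffding's lemma for a variable whose values are within `c` of each other. -/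
theorem lintegral_exp_sub_integral_le {Ω : Type*} {mΩ : MeasurableSpace Ω} {P : Measure Ω}
    [IsProbabilityMeasure P] {Y : Ω → ℝ} (hY : Measurable Y) {y c : ℝ} (hc : 0 ≤ c)
    (h : ∀ ω, |Y ω - y| ≤ c) (l : ℝ) :
    ∫⁻ ω, ENNReal.ofReal (Real.exp (l * (Y ω - ∫ ω', Y ω' ∂P))) ∂P
      ≤ ENNReal.ofReal (Real.exp (l ^ 2 * c ^ 2 / 2)) := by
  -- The interval has length `2c`, so the variance proxy is `c²`.
  have hs := hasSubgaussianMGF_of_mem_Icc (μ := P) (X := Y) (a := y - c) (b := y + c)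
    hY.aemeasurable (ae_of_all _ fun ω => by
      have := abs_le.1 (h ω); constructor <;> linarith)
  rw [← ofReal_integral_eq_lintegral_ofReal (hs.integrable_exp_mul l)
    (ae_of_all _ fun ω => (Real.exp_pos _).le)]
  refine ENNReal.ofReal_le_ofReal ((hs.mgf_le l).trans (le_of_eq ?_))
  congr 1
  have : (((‖y + c - (y - c)‖₊ / 2) ^ 2 : NNReal) : ℝ) = c ^ 2 := by
    push_cast
    rw [Real.norm_eq_abs, show y + c - (y - c) = 2 * c by ring,
      abs_of_nonneg (by linarith)]
    ring
  rw [this]; ring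

/-! ### Concentration for a contracting recursion. -/

section

variable {Ω E : Type*} {mΩ : MeasurableSpace Ω} [NormedAddCommGroup E] [MeasurableSpace E]

/-- `valueFn P f w u n s z` is the expected sum of `u` over the first `n` states of the recursion
`x ↦ f x + w` that is started from `z` at time `s`. -/
def valueFn (P : Measure Ω) (f : E → E) (w : ℕ → Ω → E) (u : E → ℝ) : ℕ → ℕ → E → ℝ
  | 0, _, _ => 0
  | n + 1, s, z => u z + ∫ ω, valueFn P f w u n (s + 1) (f z + w s ω) ∂P

/-- The effect of a perturbation of size `r` on a sum of `n` values of an `M`-Lipschitz function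
bounded by `a` along an `L`-contraction. -/
def influence (a M L : ℝ) (n : ℕ) (r : ℝ) : ℝ :=
  ∑ j ∈ Finset.range n, min (2 * a) (M * L ^ j * r)

theorem influence_mono {a M L : ℝ} (hM : 0 ≤ M) (hL : 0 ≤ L) (n : ℕ) {r r' : ℝ} (h : r ≤ r') :
    influence a M L n r ≤ influence a M L n r' := by
  unfold influence
  gcongr

theorem influence_succ {a M L : ℝ} (n : ℕ) (r : ℝ) :
    influence a M L (n + 1) r = min (2 * a) (M * r) + influence a M L n (L * r) := by
  unfold influence
  rw [Finset.sum_range_succ']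
  simp only [pow_zero, mul_one]
  rw [add_comm]
  congr 1
  exact Finset.sum_congr rfl fun j _ => by ring_nf

/-- Each minimum is at most the geometric mean of its arguments, leaving a geometric series of ratio
`√L`; its sum is at most `1/(1 - √L) = (1 + √L)/(1 - L) ≤ 2/(1 - L)`. The square root is what lets a
small `a` compensate a large `M`. -/
theorem influence_le {a M L r : ℝ} (ha : 0 ≤ a) (hM : 0 ≤ M) (hL : 0 ≤ L) (hL1 : L < 1) (n : ℕ)
    (hr : 0 ≤ r) : influence a M L n r ≤ Real.sqrt (2 * a * (M * r)) * (2 / (1 - L)) := by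
  have hs0 := Real.sqrt_nonneg L
  have hs : Real.sqrt L ^ 2 = L := Real.sq_sqrt hL
  have hs1 : Real.sqrt L < 1 := by nlinarith
  have hterm : ∀ j, min (2 * a) (M * L ^ j * r)
      ≤ Real.sqrt (2 * a * (M * r)) * Real.sqrt L ^ j := fun j => by
    have h1 : 0 ≤ min (2 * a) (M * L ^ j * r) := le_min (by positivity) (by positivity)
    rw [← pow_le_pow_iff_left₀ h1 (by positivity) two_ne_zero, mul_pow,
      Real.sq_sqrt (by positivity), ← pow_mul, mul_comm j, pow_mul, hs, sq,
      show 2 * a * (M * r) * L ^ j = 2 * a * (M * L ^ j * r) by ring]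
    exact mul_le_mul (min_le_left _ _) (min_le_right _ _) h1 (by positivity)
  have hgeom : ∑ j ∈ Finset.range n, Real.sqrt L ^ j ≤ (1 - Real.sqrt L)⁻¹ := by
    rw [← tsum_geometric_of_lt_one hs0 hs1]
    exact (summable_geometric_of_lt_one hs0 hs1).sum_le_tsum _ fun _ _ => by positivity
  calc influence a M L n r
      ≤ ∑ j ∈ Finset.range n, Real.sqrt (2 * a * (M * r)) * Real.sqrt L ^ j :=
        Finset.sum_le_sum fun j _ => hterm j
    _ = Real.sqrt (2 * a * (M * r)) * ∑ j ∈ Finset.range n, Real.sqrt L ^ j := by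
        rw [Finset.mul_sum]
    _ ≤ _ := by
        refine mul_le_mul_of_nonneg_left (hgeom.trans ?_) (Real.sqrt_nonneg _)
        rw [inv_eq_one_div, div_le_div_iff₀ (by linarith) (by linarith)]
        nlinarith

section

variable [BorelSpace E] {P : Measure Ω} [IsProbabilityMeasure P] {f : E → E} {w : ℕ → Ω → E}
  {u : E → ℝ} {L a M : ℝ} {T : ℕ}

/-- Synchronous coupling: two starting points driven by the same noise approach each other by a
factor `L` per step, while each step also costs at most `2a`. -/
theorem valueFn_bounds (hL : 0 ≤ L) (hL1 : L < 1) (hM : 0 ≤ M)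
    (hf : ∀ z z', ‖f z - f z'‖ ≤ L * ‖z - z'‖)
    (hw : ∀ t < T, Measurable (w t)) (hua : ∀ z, |u z| ≤ a)
    (huM : ∀ z z', |u z - u z'| ≤ M * ‖z - z'‖) (n : ℕ) :
    ∀ s, s + n ≤ T → Continuous (valueFn P f w u n s) ∧ (∀ z, |valueFn P f w u n s z| ≤ n * a) ∧
      ∀ z z', |valueFn P f w u n s z - valueFn P f w u n s z'| ≤ influence a M L n ‖z - z'‖ := by
  induction n with
  | zero => intro s _; simp [valueFn, influence, continuous_const]
  | succ n ih =>
    intro s hs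
    obtain ⟨hc, hb, hd⟩ := ih (s + 1) (by omega)
    have hint : ∀ z, Integrable (fun ω => valueFn P f w u n (s + 1) (f z + w s ω)) P := fun z =>
      Integrable.of_bound
        (hc.measurable.comp ((hw s (by omega)).const_add _)).aestronglyMeasurable (n * a)
        (ae_of_all _ fun ω => hb _)
    have hdiff : ∀ z z', |valueFn P f w u (n + 1) s z - valueFn P f w u (n + 1) s z'|
        ≤ influence a M L (n + 1) ‖z - z'‖ := fun z z' => by
      rw [influence_succ]
      simp only [valueFn]
      rw [add_sub_add_comm, ← integral_sub (hint z) (hint z')]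
      refine (abs_add_le _ _).trans (add_le_add (le_min ?_ (huM z z')) ?_)
      · have := abs_le.1 (hua z); have := abs_le.1 (hua z')
        rw [abs_le]; constructor <;> linarith
      · have := norm_integral_le_of_norm_le_const (μ := P)
          (f := fun ω => valueFn P f w u n (s + 1) (f z + w s ω)
            - valueFn P f w u n (s + 1) (f z' + w s ω))
          (C := influence a M L n (L * ‖z - z'‖)) (ae_of_all _ fun ω => by
            refine (hd _ _).trans (influence_mono hM hL n ?_)
            rw [add_sub_add_right_eq_sub]; exact hf z z')
        simpa using this
    refine ⟨?_, fun z => ?_, hdiff⟩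
    -- A crude Lipschitz constant that grows with `n`; it only serves continuity, hence
    -- measurability.
    · have hK : 0 ≤ (n + 1 : ℕ) * M := by positivity
      refine (LipschitzWith.of_dist_le_mul (K := ⟨_, hK⟩) fun z z' => ?_).continuous
      rw [Real.dist_eq, dist_eq_norm]
      refine (hdiff z z').trans ?_
      unfold influence
      refine (Finset.sum_le_card_nsmul _ _ (M * ‖z - z'‖) fun j _ => ?_).trans (le_of_eq ?_)
      · refine (min_le_right _ _).trans ?_
        have : L ^ j ≤ 1 := pow_le_one₀ hL hL1.le
        have : M * L ^ j ≤ M := mul_le_of_le_one_right hM this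
        gcongr
      · rw [Finset.card_range, nsmul_eq_mul, ← mul_assoc]; rfl
    · simp only [valueFn]
      refine (abs_add_le _ _).trans ?_
      have := norm_integral_le_of_norm_le_const (μ := P)
        (f := fun ω => valueFn P f w u n (s + 1) (f z + w s ω)) (C := n * a)
        (ae_of_all _ fun ω => hb _)
      simp only [probReal_univ, mul_one, Real.norm_eq_abs] at this
      push_cast
      linarith [hua z]

/-- Concentration of additive functionals of a contracting recursion with independent noise. -/
theorem lintegral_exp_sum_sub_integral_le [SecondCountableTopology E]
    (ℱ : Filtration ℕ mΩ) {y : ℕ → Ω → E} {b c : ℝ}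
    (hL : 0 ≤ L) (hL1 : L < 1) (hM : 0 ≤ M)
    (hf : ∀ z z', ‖f z - f z'‖ ≤ L * ‖z - z'‖)
    (hy : ∀ t ≤ T, Measurable[ℱ t] (y t)) (hw : ∀ t < T, Measurable[ℱ (t + 1)] (w t))
    (hind : ∀ t < T, Indep (MeasurableSpace.comap (w t) inferInstance) (ℱ t) P)
    (hdyn : ∀ t < T, ∀ ω, y (t + 1) ω = f (y t ω) + w t ω)
    (hua : ∀ z, |u z| ≤ a) (huM : ∀ z z', |u z - u z'| ≤ M * ‖z - z'‖)
    (hwb : ∀ t < T, ∀ ω, ‖w t ω‖ ≤ b) (hyb : ∀ ω ω', ‖y 0 ω - y 0 ω'‖ ≤ b)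
    (hc0 : 0 ≤ c) (hc : ∀ n, influence a M L n b ≤ c) (l : ℝ) :
    ∫⁻ ω, ENNReal.ofReal (Real.exp (l * ∑ t ∈ Finset.range T, (u (y t ω) - ∫ ω', u (y t ω') ∂P))) ∂P
      ≤ ENNReal.ofReal (Real.exp (l ^ 2 * c ^ 2 / 2 * T + |l| * c)) := by
  set V : ℕ → E → ℝ := fun s => valueFn P f w u (T - s) s with hV
  have hbounds : ∀ s ≤ T, Continuous (V s) ∧ (∀ z, |V s z| ≤ (T - s : ℕ) * a) ∧
      ∀ z z', |V s z - V s z'| ≤ influence a M L (T - s) ‖z - z'‖ := fun s hs =>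
    valueFn_bounds hL hL1 hM hf (fun t ht => (hw t ht).mono (ℱ.le _) le_rfl) hua huM _ s
      (by omega)
  have hw' : ∀ t < T, Measurable (w t) := fun t ht => (hw t ht).mono (ℱ.le _) le_rfl
  have hy' : ∀ t ≤ T, Measurable (y t) := fun t ht => (hy t ht).mono (ℱ.le _) le_rfl
  have hfc : Continuous f := (LipschitzWith.of_dist_le_mul (K := ⟨L, hL⟩) fun z z' => by
    rw [dist_eq_norm, dist_eq_norm]; exact hf z z').continuous
  have hfm : Measurable f := hfc.measurable
  have huc : Continuous u := (LipschitzWith.of_dist_le_mul (K := ⟨M, hM⟩) fun z z' => by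
    rw [Real.dist_eq, dist_eq_norm]; exact huM z z').continuous
  have hstep : ∀ s < T, ∀ z, V s z = u z + ∫ ω, V (s + 1) (f z + w s ω) ∂P := fun s hs z => by
    simp only [hV]
    rw [show T - s = T - (s + 1) + 1 by omega]
    rfl
  have hVT : ∀ z, V T z = 0 := fun z => by simp [hV, valueFn]
  -- Martingale increments: the change in expected remaining sum once `w s` is revealed.
  set D : ℕ → E → E → ℝ := fun s z v => V (s + 1) (f z + v) - ∫ ω, V (s + 1) (f z + w s ω) ∂P
    with hD
  have htel : ∀ ω, ∀ m ≤ T, ∑ t ∈ Finset.range m, u (y t ω) + V m (y m ω)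
      = V 0 (y 0 ω) + ∑ t ∈ Finset.range m, D t (y t ω) (w t ω) := fun ω m => by
    induction m with
    | zero => intro _; simp
    | succ m ih =>
      intro hm
      have h1 := ih (by omega)
      rw [Finset.sum_range_succ, Finset.sum_range_succ]
      have h2 := hstep m (by omega) (y m ω)
      simp only [hD]
      rw [← hdyn m (by omega)]
      simp only [hD] at h1
      linarith
  have hVmeas : ∀ s < T, Measurable (Function.uncurry fun z v => V (s + 1) (f z + v)) :=
    fun s hs => by
      have := (hbounds (s + 1) hs).1
      exact (this.comp (f := fun p : E × E => f p.1 + p.2) (by fun_prop)).measurable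
  have hmean : ∀ t < T, ∫ ω, V (t + 1) (f (y t ω) + w t ω) ∂P
      = ∫ ω, ∫ ω', V (t + 1) (f (y t ω) + w t ω') ∂P ∂P := fun t ht => by
    have hI : IndepFun (y t) (w t) P := by
      rw [IndepFun_iff_Indep]
      exact (indep_of_indep_of_le_right (hind t ht) (hy t ht.le).comap_le).symm
    exact integral_indep (hy' t ht.le) (hw' t ht) hI (hVmeas t ht) fun z v =>
      (hbounds (t + 1) ht).2.1 _
  have hVint : ∀ t ≤ T, Integrable (fun ω => V t (y t ω)) P := fun t ht =>
    Integrable.of_bound ((hbounds t ht).1.measurable.comp (hy' t ht)).aestronglyMeasurable _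
      (ae_of_all _ fun ω => (hbounds t ht).2.1 _)
  have huint : ∀ t ≤ T, Integrable (fun ω => u (y t ω)) P := fun t ht =>
    Integrable.of_bound (huc.measurable.comp (hy' t ht)).aestronglyMeasurable _
      (ae_of_all _ fun ω => hua _)
  have hmeanV : ∀ t < T, ∫ ω, V t (y t ω) ∂P
      = ∫ ω, u (y t ω) ∂P + ∫ ω, V (t + 1) (y (t + 1) ω) ∂P := fun t ht => by
    have e : ∀ ω, ∫ ω', V (t + 1) (f (y t ω) + w t ω') ∂P = V t (y t ω) - u (y t ω) :=
      fun ω => by rw [hstep t ht]; ring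
    have h1 := hmean t ht
    simp only [e] at h1
    rw [integral_sub (hVint t ht.le) (huint t ht.le)] at h1
    simp only [hdyn t ht]
    linarith
  have hmeansum : ∀ m ≤ T, ∑ t ∈ Finset.range m, ∫ ω, u (y t ω) ∂P + ∫ ω, V m (y m ω) ∂P
      = ∫ ω, V 0 (y 0 ω) ∂P := fun m => by
    induction m with
    | zero => intro _; simp
    | succ m ih =>
      intro hm
      rw [Finset.sum_range_succ, ← ih (by omega), hmeanV m (by omega)]
      ring
  -- The random initial state is not produced by the noise; its contribution is bounded outright,
  -- hence the summand `|l| * c` in the exponent.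
  have hosc : ∀ ω, |V 0 (y 0 ω) - ∫ ω', V 0 (y 0 ω') ∂P| ≤ c := fun ω => by
    have e : V 0 (y 0 ω) - ∫ ω', V 0 (y 0 ω') ∂P = ∫ ω', (V 0 (y 0 ω) - V 0 (y 0 ω')) ∂P := by
      rw [integral_sub (integrable_const _) (hVint 0 (Nat.zero_le _))]
      simp
    rw [e]
    have := norm_integral_le_of_norm_le_const (μ := P)
      (f := fun ω' => V 0 (y 0 ω) - V 0 (y 0 ω')) (C := c) (ae_of_all _ fun ω' =>
        ((hbounds 0 (Nat.zero_le _)).2.2 _ _).trans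
          ((influence_mono hM hL _ (hyb ω ω')).trans (hc _)))
    simpa using this
  have hsum : ∀ ω, ∑ t ∈ Finset.range T, (u (y t ω) - ∫ ω', u (y t ω') ∂P)
      = (V 0 (y 0 ω) - ∫ ω', V 0 (y 0 ω') ∂P) + ∑ t ∈ Finset.range T, D t (y t ω) (w t ω) :=
    fun ω => by
      have h1 := htel ω T le_rfl
      have h2 := hmeansum T le_rfl
      simp only [hVT, integral_zero, add_zero] at h1 h2
      rw [Finset.sum_sub_distrib, h1, h2]
      ring
  set κ : ℝ := l ^ 2 * c ^ 2 / 2 with hκ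
  -- Normalizing by `κ` makes each conditional mean at most one; the value 1 beyond the horizon
  -- makes `Φ t` measurable for all `t`.
  set Φ : ℕ → E → E → ENNReal := fun t z v =>
    if t < T then ENNReal.ofReal (Real.exp (l * D t z v - κ)) else 1 with hΦ
  have hDmeas : ∀ t < T, Measurable (Function.uncurry (D t)) := fun t ht => by
    have hfst : Measurable fun z => ∫ ω, V (t + 1) (f z + w t ω) ∂P := by
      have := ((hVmeas t ht).comp (f := fun p : E × Ω => (p.1, w t p.2))
        (measurable_fst.prodMk ((hw' t ht).comp measurable_snd))).stronglyMeasurable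
      exact (this.integral_prod_right' (ν := P)).measurable
    exact (hVmeas t ht).sub (hfst.comp measurable_fst)
  have hΦm : ∀ t, Measurable (Function.uncurry (Φ t)) := fun t => by
    by_cases ht : t < T
    · simp only [hΦ, ht, if_true]
      exact (Real.measurable_exp.comp (((hDmeas t ht).const_mul l).sub_const κ)).ennreal_ofReal
    · simp only [hΦ, ht, if_false]
      exact measurable_const
  have hkey := lintegral_prod_le_one ℱ (T := T) (fun t ht => hy t ht.le) hw hind hΦm
    (P := P) fun t ht z => by
      -- The centre is the noiseless successor: noise of size at most `b` moves the value function
      -- by at most `influence a M L _ b ≤ c`.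
      have hHoeff := lintegral_exp_sub_integral_le (P := P) (Y := fun ω => V (t + 1) (f z + w t ω))
        ((hVmeas t ht).comp (measurable_const.prodMk (hw' t ht))) (y := V (t + 1) (f z)) hc0
        (fun ω => by
          refine ((hbounds (t + 1) ht).2.2 _ _).trans
            ((influence_mono hM hL _ ?_).trans (hc _))
          rw [add_sub_cancel_left]; exact hwb t ht ω) l
      simp only [hΦ, ht, if_true]
      have e : ∀ ω, ENNReal.ofReal (Real.exp (l * D t z (w t ω) - κ))
          = ENNReal.ofReal (Real.exp (l * D t z (w t ω))) * ENNReal.ofReal (Real.exp (-κ)) :=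
        fun ω => by
          rw [← ENNReal.ofReal_mul (Real.exp_pos _).le, ← Real.exp_add, sub_eq_add_neg]
      simp only [e]
      rw [lintegral_mul_const' _ _ ENNReal.ofReal_ne_top]
      refine (mul_le_mul_left hHoeff _).trans ?_
      rw [← ENNReal.ofReal_mul (Real.exp_pos _).le, ← Real.exp_add]
      simp [hκ]
  have hprod : ∀ ω, ∏ t ∈ Finset.range T, Φ t (y t ω) (w t ω)
      = ENNReal.ofReal (Real.exp (l * ∑ t ∈ Finset.range T, D t (y t ω) (w t ω) - κ * T)) :=
    fun ω => by
      rw [Finset.prod_congr rfl fun t ht => by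
        simp only [hΦ, Finset.mem_range.1 ht, if_true]; rfl]
      rw [← ENNReal.ofReal_prod_of_nonneg fun _ _ => (Real.exp_pos _).le, ← Real.exp_sum,
        Finset.sum_sub_distrib, Finset.mul_sum]
      simp [mul_comm]
  calc ∫⁻ ω, ENNReal.ofReal
        (Real.exp (l * ∑ t ∈ Finset.range T, (u (y t ω) - ∫ ω', u (y t ω') ∂P))) ∂P
      ≤ ∫⁻ ω, (∏ t ∈ Finset.range T, Φ t (y t ω) (w t ω))
          * ENNReal.ofReal (Real.exp (κ * T + |l| * c)) ∂P := by
        refine lintegral_mono fun ω => ?_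
        rw [hprod, ← ENNReal.ofReal_mul (Real.exp_pos _).le, ← Real.exp_add]
        refine ENNReal.ofReal_le_ofReal (Real.exp_le_exp.2 ?_)
        rw [hsum, mul_add]
        have h1 : l * (V 0 (y 0 ω) - ∫ ω', V 0 (y 0 ω') ∂P) ≤ |l| * c := by
          refine (le_abs_self _).trans ?_
          rw [abs_mul]
          exact mul_le_mul_of_nonneg_left (hosc ω) (abs_nonneg _)
        linarith
    _ ≤ _ := by
        rw [lintegral_mul_const' _ _ ENNReal.ofReal_ne_top]
        exact (mul_le_mul_left hkey _).trans (by simp [one_mul])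

end

end

/-! ### The offset process of the noise. -/

/-- The offset process of a bounded, independent, centred noise has exponential moment at most
one. -/
theorem lintegral_exp_offset_le_one {Ω E : Type*} {mΩ : MeasurableSpace Ω} {P : Measure Ω}
    [IsProbabilityMeasure P] [NormedAddCommGroup E] [InnerProductSpace ℝ E] [CompleteSpace E]
    [MeasurableSpace E] [BorelSpace E] [SecondCountableTopology E] (ℱ : Filtration ℕ mΩ)
    {y w : ℕ → Ω → E} {T : ℕ} {b l : ℝ}
    (hy : ∀ t < T, Measurable[ℱ t] (y t)) (hw : ∀ t < T, Measurable[ℱ (t + 1)] (w t))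
    (hind : ∀ t < T, Indep (MeasurableSpace.comap (w t) inferInstance) (ℱ t) P)
    (hb : 0 ≤ b) (hwb : ∀ t < T, ∀ ω, ‖w t ω‖ ≤ b) (hw0 : ∀ t < T, ∫ ω, w t ω ∂P = 0)
    {g : E → E} (hg : Measurable g) (hl : 0 ≤ l) (hlb : 16 * l * b ^ 2 ≤ 1) :
    ∫⁻ ω, ENNReal.ofReal (Real.exp (l * ∑ t ∈ Finset.range T,
      (4 * inner ℝ (w t ω) (g (y t ω)) - ‖g (y t ω)‖ ^ 2 / 2))) ∂P
      ≤ ENNReal.ofReal (Real.exp 0) := by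
  have hw' : ∀ t < T, Measurable (w t) := fun t ht => (hw t ht).mono (ℱ.le _) le_rfl
  have hkey := lintegral_prod_le_one ℱ hy hw hind (P := P)
    (Φ := fun _ z v => ENNReal.ofReal (Real.exp (l * (4 * inner ℝ v (g z) - ‖g z‖ ^ 2 / 2))))
    (fun _ => by
      have h1 : Measurable fun p : E × E => g p.1 := hg.comp measurable_fst
      have h2 : Measurable fun p : E × E => inner ℝ p.2 (g p.1) := measurable_snd.inner h1
      exact (Real.measurable_exp.comp
        (((h2.const_mul 4).sub ((h1.norm.pow_const 2).div_const 2)).const_mul l)).ennreal_ofReal)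
    fun t ht z => by
      have hwi : Integrable (w t) P :=
        Integrable.of_bound (hw' t ht).aestronglyMeasurable b (ae_of_all _ (hwb t ht))
      have hm : Measurable fun ω => inner ℝ (w t ω) (g z) := (hw' t ht).inner measurable_const
      have h0 : ∫ ω, inner ℝ (w t ω) (g z) ∂P = 0 := by
        simp_rw [real_inner_comm (g z)]
        rw [integral_inner hwi, hw0 t ht, inner_zero_right]
      have hH := lintegral_exp_sub_integral_le (P := P) hm (y := 0) (c := b * ‖g z‖) (by positivity)
        (fun ω => by
          rw [sub_zero]
          exact (abs_real_inner_le_norm _ _).trans (by gcongr; exact hwb t ht ω)) (4 * l)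
      simp only [h0, sub_zero] at hH
      have e : ∀ ω, ENNReal.ofReal (Real.exp (l * (4 * inner ℝ (w t ω) (g z) - ‖g z‖ ^ 2 / 2)))
          = ENNReal.ofReal (Real.exp (4 * l * inner ℝ (w t ω) (g z)))
            * ENNReal.ofReal (Real.exp (-(l * ‖g z‖ ^ 2 / 2))) := fun ω => by
        rw [← ENNReal.ofReal_mul (Real.exp_pos _).le, ← Real.exp_add]
        ring_nf
      simp only [e]
      rw [lintegral_mul_const' _ _ ENNReal.ofReal_ne_top]
      refine (mul_le_mul_left hH _).trans ?_
      rw [← ENNReal.ofReal_mul (Real.exp_pos _).le, ← Real.exp_add, ENNReal.ofReal_le_one,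
        Real.exp_le_one_iff]
      -- Hoeffding costs `8 l² b² ‖g z‖²`, and the quadratic offset pays `l ‖g z‖² / 2`; this is
      -- where `16 l b² ≤ 1` comes from.
      have h3 : 16 * l * b ^ 2 * (l * ‖g z‖ ^ 2) ≤ 1 * (l * ‖g z‖ ^ 2) := by gcongr
      linarith
  rw [Real.exp_zero, ENNReal.ofReal_one]
  refine le_trans (le_of_eq (lintegral_congr fun ω => ?_)) hkey
  rw [← ENNReal.ofReal_prod_of_nonneg fun _ _ => (Real.exp_pos _).le, ← Real.exp_sum,
    Finset.mul_sum]

/-! ### Grids of matrices. -/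

/-- A matrix on the grid of mesh `2 C / n` in the cube of matrices with entries in `[-C, C]`. -/
def gridMatrix {d : ℕ} (C : ℝ) (n : ℕ) (k : Fin d → Fin d → Fin (n + 1)) :
    Matrix (Fin d) (Fin d) ℝ :=
  Matrix.of fun i j => -C + 2 * C * (k i j : ℕ) / n

theorem abs_gridMatrix_le {d : ℕ} {C : ℝ} (hC : 0 < C) {n : ℕ} (hn : 0 < n)
    (k : Fin d → Fin d → Fin (n + 1)) (i j : Fin d) : |gridMatrix C n k i j| ≤ C := by
  have hn' : (0 : ℝ) < n := by exact_mod_cast hn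
  have h1 : ((k i j : ℕ) : ℝ) ≤ n := by exact_mod_cast Nat.lt_succ_iff.1 (k i j).2
  have h2 : 2 * C * (k i j : ℕ) / n ≤ 2 * C := by
    rw [div_le_iff₀ hn']; gcongr
  have h3 : 0 ≤ 2 * C * (k i j : ℕ) / n := by positivity
  simp only [gridMatrix, Matrix.of_apply]
  rw [abs_le]; constructor <;> linarith

theorem exists_gridMatrix_near {d : ℕ} {C : ℝ} (hC : 0 < C) {n : ℕ} (hn : 0 < n)
    {A : Matrix (Fin d) (Fin d) ℝ} (hA : ∀ i j, |A i j| ≤ C) :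
    ∃ k, ∀ i j, |(A - gridMatrix C n k : Matrix (Fin d) (Fin d) ℝ) i j| ≤ 2 * C / n := by
  have hn' : (0 : ℝ) < n := by exact_mod_cast hn
  have hpos : ∀ i j, 0 ≤ (A i j + C) * n / (2 * C) := fun i j => by
    have := (abs_le.1 (hA i j)).1
    have : 0 ≤ A i j + C := by linarith
    positivity
  refine ⟨fun i j => ⟨⌊(A i j + C) * n / (2 * C)⌋₊, ?_⟩, fun i j => ?_⟩
  · refine Nat.lt_succ_iff.2 (Nat.floor_le_of_le ?_)
    rw [div_le_iff₀ (by positivity)]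
    have := (abs_le.1 (hA i j)).2
    nlinarith
  · have h1 := Nat.floor_le (hpos i j)
    have h2 := Nat.lt_floor_add_one ((A i j + C) * n / (2 * C))
    simp only [gridMatrix, Matrix.sub_apply, Matrix.of_apply]
    set m : ℝ := ((⌊(A i j + C) * n / (2 * C)⌋₊ : ℕ) : ℝ)
    have e : A i j - (-C + 2 * C * m / n)
        = ((A i j + C) * n / (2 * C) - m) * (2 * C / n) := by field_simp; ring
    have hq : 0 < 2 * C / n := by positivity
    rw [e, abs_mul, abs_of_pos hq, abs_of_nonneg (by linarith)]
    nlinarith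

theorem norm_matAct_le {d : ℕ} {A : Matrix (Fin d) (Fin d) ℝ} {ε : ℝ} (hε : 0 ≤ ε)
    (hA : ∀ i j, |A i j| ≤ ε) : ‖matAct A‖ ≤ d * ε := by
  refine ContinuousLinearMap.opNorm_le_bound _ (by positivity) fun z => ?_
  rw [← pow_le_pow_iff_left₀ (norm_nonneg _) (by positivity) two_ne_zero, mul_pow,
    EuclideanSpace.real_norm_sq_eq, EuclideanSpace.real_norm_sq_eq]
  have h1 : ∀ i, (matAct A z) i = ∑ j, A i j * z j := fun i => by
    simp [matAct, Matrix.ofLp_toEuclideanCLM, Matrix.mulVec, dotProduct]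
  have h2 : ∀ i, (matAct A z) i ^ 2 ≤ (d * ε ^ 2) * ∑ j, z j ^ 2 := fun i => by
    rw [h1]
    refine (Finset.sum_mul_sq_le_sq_mul_sq _ _ _).trans ?_
    refine mul_le_mul_of_nonneg_right ?_ (Finset.sum_nonneg fun _ _ => sq_nonneg _)
    refine (Finset.sum_le_card_nsmul _ _ (ε ^ 2) fun j _ => ?_).trans (by simp)
    exact sq_le_sq' (by linarith [(abs_le.1 (hA i j)).1]) (abs_le.1 (hA i j)).2
  refine (Finset.sum_le_card_nsmul _ _ _ fun i _ => h2 i).trans (le_of_eq ?_)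
  simp only [Finset.card_univ, Fintype.card_fin, nsmul_eq_mul]
  ring

theorem abs_apply_le_frobNorm {d : ℕ} (A : Matrix (Fin d) (Fin d) ℝ) (i j : Fin d) :
    |A i j| ≤ frobNorm A := by
  refine Real.abs_le_sqrt ?_
  rw [Matrix.trace]
  simp only [Matrix.diag_apply, Matrix.mul_apply, Matrix.transpose_apply]
  have h1 : A i j ^ 2 ≤ ∑ r, A r j * A r j := by
    rw [sq]
    exact Finset.single_le_sum (f := fun r => A r j * A r j)
      (fun r _ => mul_self_nonneg _) (Finset.mem_univ i)
  exact h1.trans (Finset.single_le_sum (f := fun s => ∑ r, A r s * A r s)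
    (fun s _ => Finset.sum_nonneg fun r _ => mul_self_nonneg _) (Finset.mem_univ j))

/-! ### Truncation and regularity of the distance between two models. -/

/-- Truncation to `[-a, a]`. -/
def truncate (a x : ℝ) : ℝ := max (-a) (min a x)

theorem abs_truncate_le {a : ℝ} (ha : 0 ≤ a) (x : ℝ) : |truncate a x| ≤ a :=
  abs_le.2 ⟨le_max_left _ _, max_le (by linarith) (min_le_left _ _)⟩

theorem truncate_of_abs_le {a x : ℝ} (h : |x| ≤ a) : truncate a x = x := by
  rw [truncate, min_eq_right (abs_le.1 h).2, max_eq_right (abs_le.1 h).1]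

theorem abs_truncate_sub_le (a x x' : ℝ) : |truncate a x - truncate a x'| ≤ |x - x'| := by
  unfold truncate
  refine (abs_max_sub_max_le_max _ _ _ _).trans ?_
  rw [sub_self, abs_zero]
  refine max_le (abs_nonneg _) ((abs_min_sub_min_le_max _ _ _ _).trans ?_)
  rw [sub_self, abs_zero]
  exact max_le (abs_nonneg _) le_rfl

/-- The pointwise distance between the generalized linear maps with matrices `A'` and `A`. -/
def glmDist {d : ℕ} (φ : EuclideanSpace ℝ (Fin d) → EuclideanSpace ℝ (Fin d))
    (A A' : Matrix (Fin d) (Fin d) ℝ) (z : EuclideanSpace ℝ (Fin d)) : ℝ :=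
  ‖φ (matAct A' z) - φ (matAct A z)‖

section

variable {d : ℕ} {φ : EuclideanSpace ℝ (Fin d) → EuclideanSpace ℝ (Fin d)}
  {A A' A'' : Matrix (Fin d) (Fin d) ℝ}

theorem norm_glm_sub_le (hφ : LipschitzWith 1 φ) (z : EuclideanSpace ℝ (Fin d)) :
    ‖φ (matAct A' z) - φ (matAct A'' z)‖ ≤ ‖matAct (A' - A'')‖ * ‖z‖ := by
  have h := hφ.dist_le_mul (matAct A' z) (matAct A'' z)
  rw [dist_eq_norm, dist_eq_norm, NNReal.coe_one, one_mul] at h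
  refine h.trans ?_
  have e : matAct A' z - matAct A'' z = matAct (A' - A'') z := by
    simp only [matAct, map_sub, sub_apply]
  rw [e]
  exact ContinuousLinearMap.le_opNorm _ _

theorem norm_glm_apply_sub_le (hφ : LipschitzWith 1 φ) (z z' : EuclideanSpace ℝ (Fin d)) :
    ‖φ (matAct A z) - φ (matAct A z')‖ ≤ ‖matAct A‖ * ‖z - z'‖ := by
  have h := hφ.dist_le_mul (matAct A z) (matAct A z')
  rw [dist_eq_norm, dist_eq_norm, NNReal.coe_one, one_mul, ← map_sub] at h
  exact h.trans (ContinuousLinearMap.le_opNorm _ _)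

theorem abs_glmDist_sub_le (hφ : LipschitzWith 1 φ) (z : EuclideanSpace ℝ (Fin d)) :
    |glmDist φ A A' z - glmDist φ A A'' z| ≤ ‖matAct (A' - A'')‖ * ‖z‖ := by
  refine (abs_norm_sub_norm_le _ _).trans ?_
  rw [sub_sub_sub_cancel_right]
  exact norm_glm_sub_le hφ z

theorem abs_glmDist_apply_sub_le (hφ : LipschitzWith 1 φ) (z z' : EuclideanSpace ℝ (Fin d)) :
    |glmDist φ A A' z - glmDist φ A A' z'| ≤ (‖matAct A'‖ + ‖matAct A‖) * ‖z - z'‖ := by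
  refine (abs_norm_sub_norm_le _ _).trans ?_
  rw [sub_sub_sub_comm, add_mul]
  exact (norm_sub_le _ _).trans
    (add_le_add (norm_glm_apply_sub_le hφ z z') (norm_glm_apply_sub_le hφ z z'))

theorem continuous_glmDist (hφ : LipschitzWith 1 φ) : Continuous (glmDist φ A A') := by
  have := hφ.continuous
  unfold glmDist
  fun_prop

end

theorem log_card_grid (d n : ℕ) :
    Real.log (Fintype.card (Fin d → Fin d → Fin (n + 1))) = (d : ℝ) ^ 2 * Real.log (n + 1) := by
  simp only [Fintype.card_fun, Fintype.card_fin]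
  push_cast
  rw [← pow_mul, Real.log_pow]
  push_cast
  ring

/-! ### From training error to population error, uniformly over matrices. -/

/-- The basic inequality of least squares, in offset form, up to a perturbation of the
candidate. -/
theorem sum_norm_sq_le_offset {E : Type*} [NormedAddCommGroup E] [InnerProductSpace ℝ E] {T : ℕ}
    {w ĝ g : ℕ → E} {b η : ℝ} (hw : ∀ t < T, ‖w t‖ ≤ b) (hη : ∀ t < T, ‖ĝ t - g t‖ ≤ η)
    (h : ∑ t ∈ Finset.range T, ‖w t - ĝ t‖ ^ 2 ≤ ∑ t ∈ Finset.range T, ‖w t‖ ^ 2) :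
    ∑ t ∈ Finset.range T, ‖ĝ t‖ ^ 2
      ≤ ∑ t ∈ Finset.range T, (4 * inner ℝ (w t) (g t) - ‖g t‖ ^ 2 / 2)
        + T * (4 * b * η + η ^ 2) := by
  -- Twice the optimality inequality is added. The left side equals `4⟨w, ĝ⟩ - ‖ĝ‖²`, and half of
  -- the negative square is given up in passing from `ĝ` to `g`.
  have hterm : ∀ t ∈ Finset.range T,
      ‖ĝ t‖ ^ 2 - 2 * (‖w t - ĝ t‖ ^ 2 - ‖w t‖ ^ 2)
        ≤ (4 * inner ℝ (w t) (g t) - ‖g t‖ ^ 2 / 2) + (4 * b * η + η ^ 2) := fun t ht => by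
    have ht := Finset.mem_range.1 ht
    have h1 := norm_sub_sq_real (w t) (ĝ t)
    have h2 : inner ℝ (w t) (ĝ t) = inner ℝ (w t) (g t) + inner ℝ (w t) (ĝ t - g t) := by
      rw [inner_sub_right]; ring
    have h3 : inner ℝ (w t) (ĝ t - g t) ≤ b * η :=
      (real_inner_le_norm _ _).trans
        (mul_le_mul (hw t ht) (hη t ht) (norm_nonneg _) ((norm_nonneg _).trans (hw t ht)))
    have h4 : ‖g t‖ ≤ ‖ĝ t‖ + η := by
      have := norm_sub_le (ĝ t) (ĝ t - g t)
      rw [sub_sub_cancel] at this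
      linarith [hη t ht]
    have h5 : ‖g t‖ ^ 2 ≤ (‖ĝ t‖ + η) ^ 2 := pow_le_pow_left₀ (norm_nonneg _) h4 2
    nlinarith [sq_nonneg (‖ĝ t‖ - η)]
  have := Finset.sum_le_sum hterm
  rw [Finset.sum_sub_distrib, ← Finset.mul_sum, Finset.sum_sub_distrib, Finset.sum_add_distrib]
    at this
  simp only [Finset.sum_const, Finset.card_range, nsmul_eq_mul] at this
  linarith

/-- On a bounded contracting trajectory, the population error of every matrix that fits the data
at least as well as the true one is bounded by a single random variable of small mean. -/
theorem exists_error_majorant {Ω : Type*} {mΩ : MeasurableSpace Ω} {P : Measure Ω}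
    [IsProbabilityMeasure P] {d T n₀ : ℕ}
    {φ : EuclideanSpace ℝ (Fin d) → EuclideanSpace ℝ (Fin d)} {A : Matrix (Fin d) (Fin d) ℝ}
    {B C L δ l₁ l₀ c₁ c₀ : ℝ} (ℱ : Filtration ℕ mΩ) {y w : ℕ → Ω → EuclideanSpace ℝ (Fin d)}
    (hB : 0 < B) (hC : 0 < C) (hL : 0 ≤ L) (hL1 : L < 1) (hT : 0 < T) (hn₀ : 0 < n₀)
    (hδ : 0 < δ) (hl₁ : 0 < l₁) (hl₀ : 0 < l₀)
    (hφ : LipschitzWith 1 φ) (hA : ‖matAct A‖ ≤ L)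
    (hy : ∀ t ≤ T, Measurable[ℱ t] (y t)) (hw : ∀ t < T, Measurable[ℱ (t + 1)] (w t))
    (hind : ∀ t < T, Indep (MeasurableSpace.comap (w t) inferInstance) (ℱ t) P)
    (hdyn : ∀ t < T, ∀ ω, y (t + 1) ω = φ (matAct A (y t ω)) + w t ω)
    (hyB : ∀ t ≤ T, ∀ ω, ‖y t ω‖ ≤ B) (hwB : ∀ t < T, ∀ ω, ‖w t ω‖ ≤ 2 * B)
    (hw0 : ∀ t < T, ∫ ω, w t ω ∂P = 0)
    (hc₁ : Real.sqrt (2 * (d * (2 * C / n₀) * B) * (2 * (d * C + 1) * (2 * B))) * (2 / (1 - L))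
      ≤ c₁)
    (hc₀ : Real.sqrt (2 * ((d * C + 1) * B) * ((d * C + 1) * (2 * B))) * (2 / (1 - L)) ≤ c₀) :
    ∃ G : Ω → ℝ, Integrable G P ∧
      ∫ ω, G ω ∂P ≤ 2 * (d * (2 * C / T) * B)
        + ((d ^ 2 * Real.log (T + 1) + (l₁ ^ 2 * c₁ ^ 2 / 2 * T + l₁ * c₁)) / l₁
          + (d ^ 2 * Real.log (n₀ + 1) + (l₀ ^ 2 * c₀ ^ 2 / 2 * T + l₀ * c₀)) / l₀) / T
        + δ / 2
        + (64 * B ^ 2 * (d ^ 2 * Real.log (T + 1))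
          + T * (4 * (2 * B) * (d * (2 * C / T) * B) + (d * (2 * C / T) * B) ^ 2)) / (2 * δ * T) ∧
      ∀ ω, ∀ A' : Matrix (Fin d) (Fin d) ℝ, (∀ i j, |A' i j| ≤ C) →
        ∑ t ∈ Finset.range T, ‖y (t + 1) ω - φ (matAct A' (y t ω))‖ ^ 2
          ≤ ∑ t ∈ Finset.range T, ‖y (t + 1) ω - φ (matAct A (y t ω))‖ ^ 2 →
        1 / T * ∑ t ∈ Finset.range T, ∫ ω', glmDist φ A A' (y t ω') ∂P ≤ G ω := by
  have hTr : (0 : ℝ) < T := by exact_mod_cast hT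
  have hn₀r : (0 : ℝ) < n₀ := by exact_mod_cast hn₀
  have hy' : ∀ t ≤ T, Measurable (y t) := fun t ht => (hy t ht).mono (ℱ.le _) le_rfl
  set ρ : ℝ := d * (2 * C / T) with hρ
  set ρ₀ : ℝ := d * (2 * C / n₀) with hρ₀
  have hρnn : 0 ≤ ρ := by positivity
  have hρ₀nn : 0 ≤ ρ₀ := by positivity
  have hc₁nn : 0 ≤ c₁ := le_trans (mul_nonneg (Real.sqrt_nonneg _)
    (div_nonneg zero_le_two (by linarith))) hc₁
  have hc₀nn : 0 ≤ c₀ := le_trans (mul_nonneg (Real.sqrt_nonneg _)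
    (div_nonneg zero_le_two (by linarith))) hc₀
  have hgrid : ∀ n, 0 < n → ∀ k, ‖matAct (gridMatrix (d := d) C n k)‖ ≤ d * C := fun n hn k =>
    norm_matAct_le hC.le (abs_gridMatrix_le hC hn k)
  -- `π` sends a fine grid point to a nearby coarse one.
  choose π hπ using fun k : Fin d → Fin d → Fin (T + 1) =>
    exists_gridMatrix_near hC hn₀ (abs_gridMatrix_le (d := d) hC hT k)
  have hπ' : ∀ k, ‖matAct (gridMatrix C T k - gridMatrix C n₀ (π k))‖ ≤ ρ₀ := fun k =>
    norm_matAct_le (by positivity) (hπ k)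
  have hlip : ∀ n, 0 < n → ∀ k z z', |glmDist φ A (gridMatrix C n k) z
      - glmDist φ A (gridMatrix C n k) z'| ≤ (d * C + 1) * ‖z - z'‖ := fun n hn k z z' => by
    refine (abs_glmDist_apply_sub_le hφ z z').trans ?_
    gcongr
    · exact hgrid n hn k
    · linarith
  -- The value function is evaluated at arbitrary points of the space, so global bounds are needed;
  -- truncation provides them, keeps Lipschitz constants and changes nothing on the trajectory.
  set u : (Fin d → Fin d → Fin (T + 1)) → EuclideanSpace ℝ (Fin d) → ℝ := fun k z =>
    truncate (ρ₀ * B) (glmDist φ A (gridMatrix C T k) z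
      - glmDist φ A (gridMatrix C n₀ (π k)) z) with hu
  set v : (Fin d → Fin d → Fin (n₀ + 1)) → EuclideanSpace ℝ (Fin d) → ℝ := fun k z =>
    truncate ((d * C + 1) * B) (glmDist φ A (gridMatrix C n₀ k) z) with hv
  have hulip : ∀ k z z', |u k z - u k z'| ≤ 2 * (d * C + 1) * ‖z - z'‖ := fun k z z' => by
    refine (abs_truncate_sub_le _ _ _).trans ?_
    rw [sub_sub_sub_comm]
    refine (abs_sub _ _).trans ?_
    have := hlip T hT k z z'
    have := hlip n₀ hn₀ (π k) z z'
    linarith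
  have hvlip : ∀ k z z', |v k z - v k z'| ≤ (d * C + 1) * ‖z - z'‖ := fun k z z' =>
    (abs_truncate_sub_le _ _ _).trans (hlip n₀ hn₀ k z z')
  have hub : ∀ k z, |u k z| ≤ ρ₀ * B := fun k z => abs_truncate_le (by positivity) _
  have hvb : ∀ k z, |v k z| ≤ (d * C + 1) * B := fun k z => abs_truncate_le (by positivity) _
  have hum : ∀ k, Measurable (u k) := fun k => by
    have h1 := continuous_glmDist (A := A) (A' := gridMatrix C T k) hφ
    have h2 := continuous_glmDist (A := A) (A' := gridMatrix C n₀ (π k)) hφ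
    simp only [hu, truncate]
    exact (by fun_prop : Continuous _).measurable
  have hvm : ∀ k, Measurable (v k) := fun k => by
    have h2 := continuous_glmDist (A := A) (A' := gridMatrix C n₀ k) hφ
    simp only [hv, truncate]
    exact (by fun_prop : Continuous _).measurable
  have hf : ∀ z z', ‖φ (matAct A z) - φ (matAct A z')‖ ≤ L * ‖z - z'‖ := fun z z' =>
    (norm_glm_apply_sub_le hφ z z').trans (by gcongr)
  have hyb : ∀ ω ω', ‖y 0 ω - y 0 ω'‖ ≤ 2 * B := fun ω ω' => by
    have := norm_sub_le (y 0 ω) (y 0 ω')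
    linarith [hyB 0 (Nat.zero_le _) ω, hyB 0 (Nat.zero_le _) ω']
  -- Only population minus empirical matters, hence the sign and the use of `-l₁`, `-l₀` below.
  have hdev : ∀ (q : EuclideanSpace ℝ (Fin d) → ℝ), Measurable q → Measurable fun ω =>
      -∑ t ∈ Finset.range T, (q (y t ω) - ∫ ω', q (y t ω') ∂P) := fun q hq => by
    refine (Finset.measurable_fun_sum _ fun t ht => ?_).neg
    exact (hq.comp (hy' t (Finset.mem_range.1 ht).le)).sub_const _
  obtain ⟨G₁, hG₁i, hG₁, hG₁b⟩ := exists_majorant (P := P) (l := l₁)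
    (Z := fun k ω => -∑ t ∈ Finset.range T, (u k (y t ω) - ∫ ω', u k (y t ω') ∂P))
    (v := l₁ ^ 2 * c₁ ^ 2 / 2 * T + l₁ * c₁) hl₁ (fun k => hdev _ (hum k)) fun k => by
      have := lintegral_exp_sum_sub_integral_le (P := P) (T := T) (u := u k)
        (f := fun z => φ (matAct A z)) ℱ hL hL1
        (by positivity : (0 : ℝ) ≤ 2 * (d * C + 1)) hf hy hw hind hdyn (hub k) (hulip k) hwB hyb
        hc₁nn (fun n => (influence_le (by positivity) (by positivity) hL hL1 n
          (by positivity)).trans hc₁) (-l₁)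
      rw [neg_sq, abs_neg, abs_of_pos hl₁] at this
      simpa only [mul_neg, neg_mul] using this
  obtain ⟨G₀, hG₀i, hG₀, hG₀b⟩ := exists_majorant (P := P) (l := l₀)
    (Z := fun k ω => -∑ t ∈ Finset.range T, (v k (y t ω) - ∫ ω', v k (y t ω') ∂P))
    (v := l₀ ^ 2 * c₀ ^ 2 / 2 * T + l₀ * c₀) hl₀ (fun k => hdev _ (hvm k)) fun k => by
      have := lintegral_exp_sum_sub_integral_le (P := P) (T := T) (u := v k)
        (f := fun z => φ (matAct A z)) ℱ hL hL1
        (by positivity : (0 : ℝ) ≤ d * C + 1) hf hy hw hind hdyn (hvb k) (hvlip k) hwB hyb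
        hc₀nn (fun n => (influence_le (by positivity) (by positivity) hL hL1 n
          (by positivity)).trans hc₀) (-l₀)
      rw [neg_sq, abs_neg, abs_of_pos hl₀] at this
      simpa only [mul_neg, neg_mul] using this
  set g : (Fin d → Fin d → Fin (T + 1)) → EuclideanSpace ℝ (Fin d) → EuclideanSpace ℝ (Fin d) :=
    fun k z => φ (matAct (gridMatrix C T k) z) - φ (matAct A z) with hg
  have hgm : ∀ k, Measurable (g k) := fun k => by
    have := hφ.continuous
    exact (by fun_prop : Continuous (g k)).measurable
  -- The largest admissible `l`: `16 l (2B)² = 1`.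
  obtain ⟨G₂, hG₂i, hG₂, hG₂b⟩ := exists_majorant (P := P) (l := 1 / (64 * B ^ 2)) (v := 0)
    (Z := fun k ω => ∑ t ∈ Finset.range T,
      (4 * inner ℝ (w t ω) (g k (y t ω)) - ‖g k (y t ω)‖ ^ 2 / 2)) (by positivity)
    (fun k => Finset.measurable_fun_sum _ fun t ht => by
      have ht := Finset.mem_range.1 ht
      have h1 := (hgm k).comp (hy' t ht.le)
      have h2 : Measurable (w t) := (hw t ht).mono (ℱ.le _) le_rfl
      exact ((h2.inner h1).const_mul 4).sub ((h1.norm.pow_const 2).div_const 2))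
    fun k => lintegral_exp_offset_le_one ℱ (fun t ht => hy t ht.le) hw hind (by positivity) hwB hw0
      (hgm k) (by positivity) (le_of_eq (by field_simp; norm_num))
  rw [log_card_grid] at hG₁b hG₀b hG₂b
  refine ⟨fun ω => 2 * (ρ * B) + (G₁ ω + G₀ ω) / T + δ / 2
      + (G₂ ω + T * (4 * (2 * B) * (ρ * B) + (ρ * B) ^ 2)) / (2 * δ * T),
    (((integrable_const _).add ((hG₁i.add hG₀i).div_const _)).add (integrable_const _)).add
      ((hG₂i.add (integrable_const _)).div_const _), ?_, fun ω A' hA' hfit => ?_⟩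
  · have i1 : Integrable (fun ω => (G₁ ω + G₀ ω) / T) P := (hG₁i.add hG₀i).div_const _
    have i2 : Integrable (fun ω => 2 * (ρ * B) + (G₁ ω + G₀ ω) / T) P := (integrable_const _).add i1
    have i3 : Integrable (fun ω => 2 * (ρ * B) + (G₁ ω + G₀ ω) / T + δ / 2) P :=
      i2.add (integrable_const _)
    have i4 : Integrable (fun ω => (G₂ ω + T * (4 * (2 * B) * (ρ * B) + (ρ * B) ^ 2))
      / (2 * δ * T)) P := (hG₂i.add (integrable_const _)).div_const _
    rw [integral_add i3 i4, integral_add i2 (integrable_const _),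
      integral_add (integrable_const _) i1, integral_div (T : ℝ), integral_add hG₁i hG₀i, integral_div (2 * δ * T),
      integral_add hG₂i (integrable_const _)]
    simp only [integral_const, probReal_univ, smul_eq_mul, one_mul]
    have h2 : ∫ ω, G₂ ω ∂P ≤ 64 * B ^ 2 * (d ^ 2 * Real.log (T + 1)) :=
      hG₂b.trans (le_of_eq (by field_simp; ring))
    gcongr
  · obtain ⟨k, hk⟩ := exists_gridMatrix_near hC hT hA'
    have hk' : ‖matAct (A' - gridMatrix C T k)‖ ≤ ρ := norm_matAct_le (by positivity) hk
    have hclose : ∀ t ≤ T, ∀ ω', |glmDist φ A A' (y t ω')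
        - glmDist φ A (gridMatrix C T k) (y t ω')| ≤ ρ * B := fun t ht ω' =>
      (abs_glmDist_sub_le hφ _).trans
        (mul_le_mul hk' (hyB t ht ω') (norm_nonneg _) hρnn)
    have hsplit : ∀ t ≤ T, ∀ ω', glmDist φ A (gridMatrix C T k) (y t ω')
        = u k (y t ω') + v (π k) (y t ω') := fun t ht ω' => by
      have h1 : |glmDist φ A (gridMatrix C T k) (y t ω')
          - glmDist φ A (gridMatrix C n₀ (π k)) (y t ω')| ≤ ρ₀ * B :=
        (abs_glmDist_sub_le hφ _).trans
          (mul_le_mul (hπ' k) (hyB t ht ω') (norm_nonneg _) hρ₀nn)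
      have h2 : |glmDist φ A (gridMatrix C n₀ (π k)) (y t ω')| ≤ (d * C + 1) * B := by
        rw [glmDist, abs_norm]
        refine (norm_glm_sub_le hφ _).trans
          (mul_le_mul ?_ (hyB t ht ω') (norm_nonneg _) (by positivity))
        rw [matAct, map_sub]
        refine (norm_sub_le _ _).trans (add_le_add (hgrid n₀ hn₀ _) (hA.trans hL1.le))
      simp only [hu, hv]
      rw [truncate_of_abs_le h1, truncate_of_abs_le h2]
      ring
    have hint : ∀ (q : EuclideanSpace ℝ (Fin d) → ℝ) (a : ℝ), Measurable q → (∀ z, |q z| ≤ a) →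
        ∀ t ≤ T, Integrable (fun ω' => q (y t ω')) P := fun q a hq ha t ht =>
      Integrable.of_bound (hq.comp (hy' t ht)).aestronglyMeasurable a (ae_of_all _ fun ω' => ha _)
    have hmeanle : ∀ t ≤ T, ∫ ω', glmDist φ A A' (y t ω') ∂P
        ≤ ∫ ω', u k (y t ω') ∂P + ∫ ω', v (π k) (y t ω') ∂P + ρ * B := fun t ht => by
      have i1 := hint (u k) _ (hum k) (hub k) t ht
      have i2 := hint (v (π k)) _ (hvm _) (hvb _) t ht
      have i3 : Integrable (fun ω' => u k (y t ω') + v (π k) (y t ω')) P := i1.add i2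
      have e : ∫ ω', (u k (y t ω') + v (π k) (y t ω') + ρ * B) ∂P
          = ∫ ω', u k (y t ω') ∂P + ∫ ω', v (π k) (y t ω') ∂P + ρ * B := by
        rw [integral_add i3 (integrable_const _), integral_add i1 i2]
        simp
      rw [← e]
      refine integral_mono_of_nonneg (ae_of_all _ fun ω' => norm_nonneg _)
        (i3.add (integrable_const _)) (ae_of_all _ fun ω' => ?_)
      have h1 := (abs_le.1 (hclose t ht ω')).2
      have h2 := hsplit t ht ω'
      simp only at h1 h2 ⊢
      linarith
    have hG₁' := hG₁ k ω
    have hG₀' := hG₀ (π k) ω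
    have hG₂' := hG₂ k ω
    have hS := sum_norm_sq_le_offset (T := T) (w := fun t => w t ω)
      (ĝ := fun t => φ (matAct A' (y t ω)) - φ (matAct A (y t ω))) (g := fun t => g k (y t ω))
      (b := 2 * B) (η := ρ * B) (fun t ht => hwB t ht ω)
      (fun t ht => by
        simp only [hg]
        rw [sub_sub_sub_cancel_right]
        exact (norm_glm_sub_le hφ _).trans
          (mul_le_mul hk' (hyB t ht.le ω) (norm_nonneg _) hρnn))
      (by
        refine le_trans (le_of_eq ?_) (hfit.trans (le_of_eq ?_))
        · refine Finset.sum_congr rfl fun t ht => ?_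
          rw [hdyn t (Finset.mem_range.1 ht)]
          congr 2; abel
        · refine Finset.sum_congr rfl fun t ht => ?_
          rw [hdyn t (Finset.mem_range.1 ht)]
          congr 2; abel)
    -- A deterministic `δ` linearizes the square root of the training error, so `G₂` enters linearly
    -- and expectations pass through.
    have hamgm : ∑ t ∈ Finset.range T, glmDist φ A A' (y t ω)
        ≤ T * (δ / 2) + (∑ t ∈ Finset.range T,
          ‖φ (matAct A' (y t ω)) - φ (matAct A (y t ω))‖ ^ 2) / (2 * δ) := by
      have h1 : ∀ t ∈ Finset.range T, glmDist φ A A' (y t ω)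
          ≤ δ / 2 + ‖φ (matAct A' (y t ω)) - φ (matAct A (y t ω))‖ ^ 2 / (2 * δ) := fun t _ => by
        rw [glmDist, div_add_div _ _ two_ne_zero (by positivity), le_div_iff₀ (by positivity)]
        nlinarith [sq_nonneg (δ - ‖φ (matAct A' (y t ω)) - φ (matAct A (y t ω))‖)]
      refine (Finset.sum_le_sum h1).trans (le_of_eq ?_)
      rw [Finset.sum_add_distrib, Finset.sum_div, Finset.sum_const, Finset.card_range, nsmul_eq_mul]
    -- The discretization error `ρ * B` is paid twice: in the population mean and on the sample.
    have hmain : ∑ t ∈ Finset.range T, ∫ ω', glmDist φ A A' (y t ω') ∂P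
        ≤ T * (2 * (ρ * B)) + (G₁ ω + G₀ ω) + ∑ t ∈ Finset.range T, glmDist φ A A' (y t ω) := by
      have h1 : ∀ t ∈ Finset.range T, ∫ ω', glmDist φ A A' (y t ω') ∂P
          ≤ 2 * (ρ * B) + -(u k (y t ω) - ∫ ω', u k (y t ω') ∂P)
            + -(v (π k) (y t ω) - ∫ ω', v (π k) (y t ω') ∂P) + glmDist φ A A' (y t ω) :=
        fun t ht => by
          have ht := (Finset.mem_range.1 ht).le
          have := hmeanle t ht
          have := hsplit t ht ω
          have := (abs_le.1 (hclose t ht ω)).1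
          linarith
      refine (Finset.sum_le_sum h1).trans ?_
      rw [Finset.sum_add_distrib, Finset.sum_add_distrib, Finset.sum_add_distrib]
      simp only [Finset.sum_neg_distrib, Finset.sum_const, Finset.card_range, nsmul_eq_mul]
      linarith
    rw [one_div, inv_mul_le_iff₀ hTr]
    have e : (T : ℝ) * (2 * (ρ * B) + (G₁ ω + G₀ ω) / T + δ / 2
        + (G₂ ω + T * (4 * (2 * B) * (ρ * B) + (ρ * B) ^ 2)) / (2 * δ * T))
        = T * (2 * (ρ * B)) + (G₁ ω + G₀ ω) + (T * (δ / 2)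
          + (G₂ ω + T * (4 * (2 * B) * (ρ * B) + (ρ * B) ^ 2)) / (2 * δ)) := by
      field_simp
      ring
    rw [e]
    refine hmain.trans (add_le_add le_rfl (hamgm.trans (add_le_add le_rfl ?_)))
    exact div_le_div_of_nonneg_right (hS.trans (by linarith)) (by positivity)

/-! ### Choice of parameters and final constants. -/

/-- The numerical conditions on the horizon under which the error bound takes its final form. -/
theorem exists_horizon {B C : ℝ} (hB : 0 < B) (hC : 0 < C) (q : ℝ) :
    ∃ T₀ : ℕ, ∀ T : ℕ, T₀ ≤ T → 0 < T ∧ q ≤ Real.sqrt (Real.log (1 + 2 * B * C * T)) ∧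
      Real.log (T + 1) ≤ 2 * Real.log (1 + 2 * B * C * T) := by
  have hp : 0 < 2 * B * C := by positivity
  have h1 : Filter.Tendsto (fun T : ℕ => Real.sqrt (Real.log (1 + 2 * B * C * T)))
      Filter.atTop Filter.atTop := by
    refine Real.tendsto_sqrt_atTop.comp (Real.tendsto_log_atTop.comp ?_)
    exact Filter.tendsto_atTop_add_const_left _ _
      (tendsto_natCast_atTop_atTop.const_mul_atTop hp)
  have h2 : ∀ᶠ T : ℕ in Filter.atTop, 1 / (2 * B * C) ^ 2 ≤ (T : ℝ) :=
    tendsto_natCast_atTop_atTop.eventually_ge_atTop _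
  obtain ⟨T₀, hT₀⟩ := Filter.eventually_atTop.1
    ((Filter.eventually_gt_atTop 0).and ((h1.eventually_ge_atTop q).and h2))
  refine ⟨T₀, fun T hT => ⟨(hT₀ T hT).1, (hT₀ T hT).2.1, ?_⟩⟩
  have h3 := (hT₀ T hT).2.2
  rw [div_le_iff₀ (by positivity)] at h3
  have hT0 : (0 : ℝ) ≤ T := Nat.cast_nonneg T
  have e : 2 * Real.log (1 + 2 * B * C * T) = Real.log ((1 + 2 * B * C * T) ^ 2) := by
    rw [Real.log_pow]; norm_num
  rw [e]
  refine Real.log_le_log (by positivity) ?_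
  -- With `p = 2BC` and `p² T ≥ 1`: `(1 + pT)² ≥ 1 + p² T² ≥ 1 + T`.
  nlinarith [mul_nonneg hp.le hT0, mul_le_mul_of_nonneg_left h3 hT0]

/-- The optimized form of the bound of `exists_error_majorant`. -/
theorem error_bound_le {B C L c₀ Λ R D s τ : ℝ} {d T n₀ : ℕ} (hB : 0 < B) (hC : 0 < C)
    (hL : 0 ≤ L) (hL1 : L < 1) (hd : 0 < d) (hT : 0 < T) (hs : 0 < s) (hτ : τ = Real.sqrt T)
    (hD : D = d * s) (hR : R = B * D / ((1 - L) * τ)) (hΛ : Λ ≤ 2 * s ^ 2)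
    (hc₀ : 0 ≤ c₀) (hs1 : 1 ≤ s) (hsC : 4 * C + 2 * C ^ 2 + 8 ≤ s)
    (hs0 : d ^ 2 * Real.log (n₀ + 1) + c₀ ^ 2 / 2 + c₀ ≤ B * s) :
    2 * (d * (2 * C / T) * B)
        + ((d ^ 2 * Λ + ((D * (1 - L) / (2 * B * τ)) ^ 2 * (2 * B / (1 - L)) ^ 2 / 2 * T
              + D * (1 - L) / (2 * B * τ) * (2 * B / (1 - L)))) / (D * (1 - L) / (2 * B * τ))
          + (d ^ 2 * Real.log (n₀ + 1) + ((1 / τ) ^ 2 * c₀ ^ 2 / 2 * T + 1 / τ * c₀)) / (1 / τ)) / T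
        + R / 2
        + (64 * B ^ 2 * (d ^ 2 * Λ)
          + T * (4 * (2 * B) * (d * (2 * C / T) * B) + (d * (2 * C / T) * B) ^ 2)) / (2 * R * T)
      ≤ 100 * R := by
  have hTr : (1 : ℝ) ≤ T := by exact_mod_cast hT
  have hdr : (1 : ℝ) ≤ d := by exact_mod_cast hd
  have hτ2 : τ ^ 2 = T := by rw [hτ]; exact Real.sq_sqrt (by linarith)
  have hτ1 : 1 ≤ τ := by rw [hτ]; exact Real.one_le_sqrt.2 hTr
  have hτ0 : 0 < τ := by linarith
  have hp : 0 < 1 - L := by linarith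
  have hp1 : 1 - L ≤ 1 := by linarith
  have hD0 : 0 < D := by rw [hD]; positivity
  have hDd : (d : ℝ) ≤ D := hD ▸ le_mul_of_one_le_right (by positivity) hs1
  have hDs : s ≤ D := hD ▸ le_mul_of_one_le_left hs.le hdr
  have hD1 : 1 ≤ D := hdr.trans hDd
  have hR0 : 0 < R := by rw [hR]; positivity
  have hRB : B * D / τ ≤ R := by
    rw [hR]
    exact div_le_div_of_nonneg_left (by positivity) (by positivity)
      (mul_le_of_le_one_left hτ0.le hp1)
  have hRBm : B * D ≤ R * τ := by rwa [div_le_iff₀ hτ0] at hRB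
  have hdΛ : d ^ 2 * Λ ≤ 2 * D ^ 2 := by
    rw [hD]; linarith [mul_le_mul_of_nonneg_left hΛ (sq_nonneg (d : ℝ))]
  have h4C : 4 * C ≤ s := by linarith [sq_nonneg C]
  have hCd : 4 * (C * d) ≤ D := by
    rw [hD]; linarith [mul_le_mul_of_nonneg_left h4C (zero_le_one.trans hdr)]
  rw [← hτ2]
  -- discretization
  have b1 : 2 * (d * (2 * C / τ ^ 2) * B) ≤ R := by
    have : 2 * (d * (2 * C / τ ^ 2) * B) = (4 * C * d * B) / τ ^ 2 := by ring
    rw [this, div_le_iff₀ (by positivity)]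
    have h1 : 4 * C * d ≤ D := by linarith
    have h2 : 4 * C * d * B ≤ D * B := by gcongr
    have h3 : R * τ ≤ R * τ ^ 2 :=
      mul_le_mul_of_nonneg_left (le_self_pow₀ hτ1 two_ne_zero) hR0.le
    linarith
  -- fine scale
  have b2 : (d ^ 2 * Λ + ((D * (1 - L) / (2 * B * τ)) ^ 2 * (2 * B / (1 - L)) ^ 2 / 2 * τ ^ 2
      + D * (1 - L) / (2 * B * τ) * (2 * B / (1 - L)))) / (D * (1 - L) / (2 * B * τ)) / τ ^ 2
      ≤ 7 * R := by
    have e : (D * (1 - L) / (2 * B * τ)) ^ 2 * (2 * B / (1 - L)) ^ 2 / 2 * τ ^ 2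
      + D * (1 - L) / (2 * B * τ) * (2 * B / (1 - L)) = D ^ 2 / 2 + D / τ := by
      field_simp
    rw [e, div_div]
    -- In terms of `R`, the tilt satisfies `l₁ T = D² / (2R)`, so a numerator of at most `7/2 D²`
    -- yields `7R`.
    have e2 : D * (1 - L) / (2 * B * τ) * τ ^ 2 = D ^ 2 / (2 * R) := by
      rw [hR]; field_simp
    rw [e2, div_le_iff₀ (by positivity)]
    have e3 : 7 * R * (D ^ 2 / (2 * R)) = 7 / 2 * D ^ 2 := by field_simp
    rw [e3]
    have h1 : D / τ ≤ D ^ 2 := (div_le_self hD0.le hτ1).trans (le_self_pow₀ hD1 two_ne_zero)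
    linarith
  -- coarse scale
  have b3 : (d ^ 2 * Real.log (n₀ + 1) + ((1 / τ) ^ 2 * c₀ ^ 2 / 2 * τ ^ 2 + 1 / τ * c₀)) / (1 / τ)
      / τ ^ 2 ≤ R := by
    have e : (1 / τ) ^ 2 * c₀ ^ 2 / 2 * τ ^ 2 = c₀ ^ 2 / 2 := by field_simp
    have e2 : 1 / τ * τ ^ 2 = τ := by field_simp
    rw [e, div_div, e2, div_le_iff₀ hτ0]
    have h1 : 1 / τ * c₀ ≤ c₀ := by
      rw [one_div_mul_eq_div]; exact div_le_self hc₀ hτ1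
    have h2 : B * s ≤ B * D := by gcongr
    linarith
  -- training error
  have b4 : (64 * B ^ 2 * (d ^ 2 * Λ)
      + τ ^ 2 * (4 * (2 * B) * (d * (2 * C / τ ^ 2) * B) + (d * (2 * C / τ ^ 2) * B) ^ 2))
      / (2 * R * τ ^ 2) ≤ 67 * R := by
    rw [div_le_iff₀ (by positivity)]
    have h1 : (B * D) ^ 2 ≤ (R * τ) ^ 2 := pow_le_pow_left₀ (by positivity) hRBm 2
    have h2 : 64 * B ^ 2 * (d ^ 2 * Λ) ≤ 64 * B ^ 2 * (2 * D ^ 2) := by gcongr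
    have e : τ ^ 2 * (4 * (2 * B) * (d * (2 * C / τ ^ 2) * B) + (d * (2 * C / τ ^ 2) * B) ^ 2)
        = 16 * (C * d) * B ^ 2 + 4 * (C * d) ^ 2 * B ^ 2 / τ ^ 2 := by
      field_simp; ring
    have h3 : 4 * (C * d) ^ 2 * B ^ 2 / τ ^ 2 ≤ 4 * (C * d) ^ 2 * B ^ 2 :=
      div_le_self (by positivity) (one_le_pow₀ hτ1)
    have h5 : 4 * (C * d) ≤ D ^ 2 := hCd.trans (le_self_pow₀ hD1 two_ne_zero)
    have h7 : 16 * (C * d) ^ 2 ≤ D ^ 2 := by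
      have := pow_le_pow_left₀ (by positivity) hCd 2
      rw [mul_pow] at this
      linarith
    have h8 : (16 * (C * d) + 4 * (C * d) ^ 2) * B ^ 2 ≤ (5 * D ^ 2) * B ^ 2 := by
      gcongr; linarith [sq_nonneg D]
    rw [e]
    rw [mul_pow] at h1
    have h9 : 0 ≤ B ^ 2 * D ^ 2 := by positivity
    have h10 : 67 * R * (2 * R * τ ^ 2) = 134 * (R * τ) ^ 2 := by ring
    rw [h10]
    linarith
  rw [add_div]
  linarith

/-! ### The fresh sample and the least squares estimator. -/

theorem integral_mixtureLaw {Ω S : Type*} [MeasurableSpace Ω] {P : Measure Ω} [MeasurableSpace S]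
    {T : ℕ} {x : ℕ → Ω → S} (hx : ∀ t < T, Measurable (x t)) {h : S → ℝ}
    (hh : Measurable h) (hi : ∀ t < T, Integrable (fun ω => h (x t ω)) P) :
    ∫ z, h z ∂(mixtureLaw P T x) = 1 / T * ∑ t ∈ Finset.range T, ∫ ω, h (x t ω) ∂P := by
  rw [mixtureLaw, integral_smul_measure, integral_finsetSum_measure]
  · simp only [ENNReal.toReal_inv, ENNReal.toReal_natCast, smul_eq_mul, one_div]
    congr 1
    refine Finset.sum_congr rfl fun t ht => ?_
    exact integral_map (hx t (Finset.mem_range.1 ht)).aemeasurable hh.aestronglyMeasurable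
  · intro t ht
    have ht := Finset.mem_range.1 ht
    exact (integrable_map_measure hh.aestronglyMeasurable (hx t ht).aemeasurable).2 (hi t ht)

theorem isProbabilityMeasure_mixtureLaw {Ω S : Type*} [MeasurableSpace Ω] {P : Measure Ω}
    [IsProbabilityMeasure P] [MeasurableSpace S] {T : ℕ} (hT : 0 < T) {x : ℕ → Ω → S}
    (hx : ∀ t < T, Measurable (x t)) : IsProbabilityMeasure (mixtureLaw P T x) := by
  constructor
  have h1 : ∀ t ∈ Finset.range T, P.map (x t) Set.univ = 1 := fun t ht => by
    rw [Measure.map_apply (hx t (Finset.mem_range.1 ht)) MeasurableSet.univ]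
    simp
  rw [mixtureLaw, Measure.smul_apply, Measure.finsetSum_apply, Finset.sum_congr rfl h1]
  simp only [Finset.sum_const, Finset.card_range, nsmul_eq_mul, mul_one, smul_eq_mul]
  exact ENNReal.inv_mul_cancel (by exact_mod_cast hT.ne') (ENNReal.natCast_ne_top T)

/-- The increments have size proportional to `1/n₀`, so a mesh depending only on `d` and `C` beats
their Lipschitz constant `2(dC + 1)` and removes `d` and `C` from the fluctuation scale. -/
theorem exists_coarse_scale (C : ℝ) (d : ℕ) :
    ∃ n₀ : ℕ, 0 < n₀ ∧ ∀ B L : ℝ, 0 < B → L < 1 →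
      Real.sqrt (2 * (d * (2 * C / n₀) * B) * (2 * (d * C + 1) * (2 * B))) * (2 / (1 - L))
        ≤ 2 * B / (1 - L) := by
  obtain ⟨n, hn⟩ := exists_nat_ge (16 * (d * C) * (d * C + 1))
  refine ⟨n + 1, Nat.succ_pos n, fun B L hB hL => ?_⟩
  have hp : 0 < 1 - L := by linarith
  have hs : Real.sqrt (2 * (d * (2 * C / (n + 1 : ℕ)) * B) * (2 * (d * C + 1) * (2 * B))) ≤ B := by
    rw [Real.sqrt_le_left hB.le]
    have e : 2 * (d * (2 * C / (n + 1 : ℕ)) * B) * (2 * (d * C + 1) * (2 * B))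
        = 16 * (d * C) * (d * C + 1) / (n + 1 : ℕ) * B ^ 2 := by ring
    rw [e]
    refine mul_le_of_le_one_left (sq_nonneg B) ?_
    rw [div_le_one (by positivity)]
    push_cast
    linarith
  calc _ ≤ B * (2 / (1 - L)) := by gcongr
    _ = _ := by ring

section

variable {d T : ℕ} {B C L σ : ℝ} {X : Set (EuclideanSpace ℝ (Fin d))}
  {φ : EuclideanSpace ℝ (Fin d) → EuclideanSpace ℝ (Fin d)} {A : Matrix (Fin d) (Fin d) ℝ}
  {Ω : Type*} {mΩ : MeasurableSpace Ω} {P : Measure Ω} {ℱ : Filtration ℕ mΩ} {x : ℕ → Ω → X}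
  {w : ℕ → Ω → EuclideanSpace ℝ (Fin d)} {fstar : C(X, X)} {fhat : Ω → C(X, X)}

/-- Carathéodory: continuity in the point and measurability in `ω` give joint measurability. -/
theorem IsLSE.measurable_error (hlse : IsLSE T x (glmClass X φ C) fhat)
    (hfs : ∀ z : X, (fstar z : EuclideanSpace ℝ (Fin d)) = φ (matAct A z)) :
    Measurable fun p : Ω × X =>
      ‖(fhat p.1 p.2 : EuclideanSpace ℝ (Fin d)) - φ (matAct A p.2)‖ := by
  have h1 : Measurable (Function.uncurry fun (z : X) (ω : Ω) => fhat ω z) :=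
    measurable_uncurry_of_continuous_of_measurable (fun ω => (fhat ω).continuous)
      hlse.measurable_eval
  have h2 : Measurable fun p : Ω × X => (fhat p.1 p.2 : EuclideanSpace ℝ (Fin d)) :=
    measurable_subtype_coe.comp (h1.comp measurable_swap)
  have h3 : Measurable fun p : Ω × X => (fstar p.2 : EuclideanSpace ℝ (Fin d)) :=
    measurable_subtype_coe.comp (fstar.continuous.measurable.comp measurable_snd)
  simp only [← hfs]
  exact (h2.sub h3).norm

theorem norm_error_le (hX : ∀ z ∈ X, ‖z‖ ≤ B)
    (hfs : ∀ z : X, (fstar z : EuclideanSpace ℝ (Fin d)) = φ (matAct A z)) (f : C(X, X)) (z : X) :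
    ‖(f z : EuclideanSpace ℝ (Fin d)) - φ (matAct A z)‖ ≤ 2 * B := by
  rw [← hfs]
  refine (norm_sub_le _ _).trans ?_
  linarith [hX _ (f z).2, hX _ (fstar z).2]

/-- The expected population error is bounded by the mean of any majorant of the population error
of the well-fitting matrices. -/
theorem IsLSE.integral_error_le [IsProbabilityMeasure P] (hT : 0 < T) (hX : ∀ z ∈ X, ‖z‖ ≤ B)
    (hmem : fstar ∈ glmClass X φ C)
    (hfs : ∀ z : X, (fstar z : EuclideanSpace ℝ (Fin d)) = φ (matAct A z))
    (htraj : IsGLMTrajectory P X φ A σ T ℱ x w) (hlse : IsLSE T x (glmClass X φ C) fhat)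
    {G : Ω → ℝ} (hG : Integrable G P)
    (h : ∀ ω, ∀ A' : Matrix (Fin d) (Fin d) ℝ, (∀ i j, |A' i j| ≤ C) →
        ∑ t ∈ Finset.range T,
          ‖(x (t + 1) ω : EuclideanSpace ℝ (Fin d)) - φ (matAct A' (x t ω))‖ ^ 2
          ≤ ∑ t ∈ Finset.range T,
            ‖(x (t + 1) ω : EuclideanSpace ℝ (Fin d)) - φ (matAct A (x t ω))‖ ^ 2 →
        1 / T * ∑ t ∈ Finset.range T, ∫ ω', glmDist φ A A' (x t ω') ∂P ≤ G ω) :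
    Integrable (fun p : Ω × X =>
        ‖(fhat p.1 p.2 : EuclideanSpace ℝ (Fin d)) - φ (matAct A p.2)‖)
        (P.prod (mixtureLaw P T x)) ∧
      ∫ p : Ω × X, ‖(fhat p.1 p.2 : EuclideanSpace ℝ (Fin d)) - φ (matAct A p.2)‖
          ∂(P.prod (mixtureLaw P T x)) ≤ ∫ ω, G ω ∂P := by
  have hx : ∀ t < T, Measurable (x t) := fun t ht =>
    (htraj.measurable_state t ht.le).mono (ℱ.le _) le_rfl
  have := isProbabilityMeasure_mixtureLaw (P := P) hT hx
  have hm := hlse.measurable_error hfs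
  have hint : Integrable (fun p : Ω × X =>
      ‖(fhat p.1 p.2 : EuclideanSpace ℝ (Fin d)) - φ (matAct A p.2)‖)
      (P.prod (mixtureLaw P T x)) :=
    Integrable.of_bound hm.aestronglyMeasurable (2 * B) (ae_of_all _ fun p => by
      rw [norm_norm]; exact norm_error_le hX hfs _ _)
  refine ⟨hint, ?_⟩
  -- By Fubini, the training data is frozen at `ω` and the fresh sample averaged first; the majorant
  -- then applies to any matrix representing `fhat ω`.
  rw [integral_prod _ hint]
  refine integral_mono hint.integral_prod_left hG fun ω => ?_
  obtain ⟨A', hA', hfA'⟩ := hlse.mem ω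
  have hmω : Measurable fun z : X =>
      ‖(fhat ω z : EuclideanSpace ℝ (Fin d)) - φ (matAct A z)‖ :=
    hm.comp (g := fun p : Ω × X => _) (f := fun z : X => (ω, z)) measurable_prodMk_left
  have hmix := integral_mixtureLaw (P := P) hx hmω fun t ht =>
    Integrable.of_bound (hmω.comp (hx t ht)).aestronglyMeasurable (2 * B)
      (ae_of_all _ fun ω' => by rw [norm_norm]; exact norm_error_le hX hfs _ _)
  simp only at hmix ⊢
  rw [hmix]
  simp only [hfA']
  refine h ω A' (fun i j => (abs_apply_le_frobNorm A' i j).trans hA') ?_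
  have hmin := hlse.isMin ω fstar hmem
  simp only [empiricalLoss, hfA', hfs] at hmin
  exact le_of_mul_le_mul_left hmin (by positivity)

end

theorem IsGLMTrajectory.norm_noise_le {d T : ℕ} {B σ : ℝ} {X : Set (EuclideanSpace ℝ (Fin d))}
    {φ : EuclideanSpace ℝ (Fin d) → EuclideanSpace ℝ (Fin d)} {A : Matrix (Fin d) (Fin d) ℝ}
    {Ω : Type*} {mΩ : MeasurableSpace Ω} {P : Measure Ω} {ℱ : Filtration ℕ mΩ} {x : ℕ → Ω → X}
    {w : ℕ → Ω → EuclideanSpace ℝ (Fin d)} {fstar : C(X, X)}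
    (htraj : IsGLMTrajectory P X φ A σ T ℱ x w) (hX : ∀ z ∈ X, ‖z‖ ≤ B)
    (hfs : ∀ z : X, (fstar z : EuclideanSpace ℝ (Fin d)) = φ (matAct A z)) {t : ℕ} (ht : t < T)
    (ω : Ω) : ‖w t ω‖ ≤ 2 * B := by
  have h1 := htraj.dynamics t ht ω
  rw [← hfs] at h1
  rw [← sub_eq_of_eq_add' h1]
  refine (norm_sub_le _ _).trans ?_
  linarith [hX _ (x (t + 1) ω).2, hX _ (fstar (x t ω)).2]

theorem IsGLMTrajectory.integral_noise {d T : ℕ} {σ : ℝ} {X : Set (EuclideanSpace ℝ (Fin d))}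
    {φ : EuclideanSpace ℝ (Fin d) → EuclideanSpace ℝ (Fin d)} {A : Matrix (Fin d) (Fin d) ℝ}
    {Ω : Type*} {mΩ : MeasurableSpace Ω} {P : Measure Ω} [IsProbabilityMeasure P]
    {ℱ : Filtration ℕ mΩ} {x : ℕ → Ω → X} {w : ℕ → Ω → EuclideanSpace ℝ (Fin d)}
    (htraj : IsGLMTrajectory P X φ A σ T ℱ x w) {t : ℕ} (ht : t < T) : ∫ ω, w t ω ∂P = 0 := by
  rw [← integral_condExp (ℱ.le t), integral_congr_ae (htraj.condExp_noise t ht)]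
  simp

end

theorem mainTheorem11 :
    ∃ K : ℝ, 0 < K ∧
      ∀ (d : ℕ) (σ B C L : ℝ), 0 ≤ σ → 0 < C → L < 1 →
      ∃ T₀ : ℕ, ∀ T : ℕ, T₀ ≤ T →
      ∀ (X : Set (EuclideanSpace ℝ (Fin d))), (∀ z ∈ X, ‖z‖ ≤ B) →
      ∀ (φ : EuclideanSpace ℝ (Fin d) → EuclideanSpace ℝ (Fin d)), LipschitzWith 1 φ →
      ∀ (A : Matrix (Fin d) (Fin d) ℝ), ‖matAct A‖ ≤ L →
      -- the regression function `φ (A ·)` belongs to the hypothesis class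
      ∀ fstar ∈ glmClass X φ C,
        (∀ z : X, (fstar z : EuclideanSpace ℝ (Fin d)) = φ (matAct A z)) →
      ∀ (Ω : Type*) (mΩ : MeasurableSpace Ω) (P : Measure Ω), IsProbabilityMeasure P →
      ∀ (ℱ : Filtration ℕ mΩ) (x : ℕ → Ω → X) (w : ℕ → Ω → EuclideanSpace ℝ (Fin d)),
        IsGLMTrajectory P X φ A σ T ℱ x w →
      ∀ fhat : Ω → C(X, X), IsLSE T x (glmClass X φ C) fhat →
      -- the fresh sample `ξ` is the second coordinate, independent of `fhat` by the product
      Integrable (fun p : Ω × X =>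
          ‖(fhat p.1 p.2 : EuclideanSpace ℝ (Fin d)) - φ (matAct A p.2)‖)
        (P.prod (mixtureLaw P T x)) ∧
      ∫ p : Ω × X, ‖(fhat p.1 p.2 : EuclideanSpace ℝ (Fin d)) - φ (matAct A p.2)‖
          ∂(P.prod (mixtureLaw P T x))
        ≤ K * (Real.sqrt (σ ^ 2 / T * (d : ℝ) ^ 2 *
                Real.log (1 + 2 * σ * Real.sqrt d * B * C * (T : ℝ) ^ 2))
            + Real.sqrt (B ^ 2 / ((1 - L) ^ 2 * T) * (d : ℝ) ^ 2 *
                Real.log (1 + 2 * B * C * T))) := by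
  -- The contributions add up to `1 + 7 + 1 + 1/2 + 67` times `R`, which is below `100 R`.
  refine ⟨100, by norm_num, fun d σ B C L _ hC hL1 => ?_⟩
  -- In these cases the error vanishes identically; afterwards division by `B` is allowed.
  by_cases hdeg : d = 0 ∨ B ≤ 0
  · refine ⟨0, fun T _ X hX φ _ A _ fstar _ hfs Ω mΩ P _ ℱ x w _ fhat _ => ?_⟩
    have h0 : ∀ p : Ω × X, ‖(fhat p.1 p.2 : EuclideanSpace ℝ (Fin d)) - φ (matAct A p.2)‖ = 0 := by
      intro p
      rcases hdeg with rfl | hB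
      · rw [norm_eq_zero]; exact Subsingleton.elim _ _
      · exact le_antisymm ((norm_error_le hX hfs _ _).trans (by linarith)) (norm_nonneg _)
    simp only [h0]
    refine ⟨integrable_zero _ _ _, ?_⟩
    rw [integral_zero]
    positivity
  push Not at hdeg
  obtain ⟨hd, hB⟩ := hdeg
  have hd := Nat.pos_of_ne_zero hd
  obtain ⟨n₀, hn₀, hc₁⟩ := exists_coarse_scale C d
  set c₀ : ℝ := Real.sqrt (2 * ((d * C + 1) * B) * ((d * C + 1) * (2 * B))) * (2 / (1 - L)) with hc₀
  have hp : 0 < 1 - L := by linarith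
  have hc₀nn : 0 ≤ c₀ := by positivity
  -- The thresholds make `√log(1 + 2BCT)` dominate the constants of the discretization and of the
  -- coarse grid.
  obtain ⟨T₀, hT₀⟩ := exists_horizon hB hC
    (max 1 (max (4 * C + 2 * C ^ 2 + 8) ((d ^ 2 * Real.log (n₀ + 1) + c₀ ^ 2 / 2 + c₀) / B)))
  refine ⟨T₀, fun T hT X hX φ hφ A hA fstar hmem hfs Ω mΩ P hP ℱ x w htraj fhat hlse => ?_⟩
  have hL : 0 ≤ L := (norm_nonneg _).trans hA
  obtain ⟨hTpos, hq, hlog⟩ := hT₀ T hT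
  set s := Real.sqrt (Real.log (1 + 2 * B * C * T)) with hs
  simp only [max_le_iff] at hq
  obtain ⟨hs1, hsC, hs0⟩ := hq
  rw [div_le_iff₀ hB, mul_comm s] at hs0
  have hTr : (0 : ℝ) < T := by exact_mod_cast hTpos
  have hτ0 : 0 < Real.sqrt T := Real.sqrt_pos.2 hTr
  have hlnn : 0 ≤ Real.log (1 + 2 * B * C * T) :=
    Real.log_nonneg (by linarith [show 0 ≤ 2 * B * C * T by positivity])
  have hs2 : s ^ 2 = Real.log (1 + 2 * B * C * T) := Real.sq_sqrt hlnn
  have hspos : 0 < s := by linarith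
  have hdr : (0 : ℝ) < d := by exact_mod_cast hd
  set R : ℝ := B * (d * s) / ((1 - L) * Real.sqrt T) with hR
  have hRpos : 0 < R := by positivity
  have hRs : R = Real.sqrt (B ^ 2 / ((1 - L) ^ 2 * T) * (d : ℝ) ^ 2 *
      Real.log (1 + 2 * B * C * T)) := by
    rw [← hs2, eq_comm, Real.sqrt_eq_iff_eq_sq (by positivity) hRpos.le, hR, div_pow, mul_pow,
      mul_pow, mul_pow, Real.sq_sqrt hTr.le]
    ring
  have hys : ∀ t ≤ T, Measurable[ℱ t] fun ω => (x t ω : EuclideanSpace ℝ (Fin d)) := fun t ht =>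
    measurable_subtype_coe.comp (htraj.measurable_state t ht)
  -- `l₁ = d s / (c₁ √T)` balances entropy against variance on the fine grid; on the coarse grid
  -- `1/√T` is enough. The linearization parameter `δ` is the target rate `R`.
  obtain ⟨G, hGi, hGb, hG⟩ := exists_error_majorant (P := P) ℱ hB hC hL hL1 hTpos hn₀ hRpos
    (l₁ := d * s * (1 - L) / (2 * B * Real.sqrt T)) (l₀ := 1 / Real.sqrt T)
    (c₁ := 2 * B / (1 - L)) (c₀ := c₀) (by positivity) (by positivity) hφ hA hys
    htraj.measurable_noise htraj.indep_noise htraj.dynamics (fun t _ ω => hX _ (x t ω).2)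
    (fun t ht ω => htraj.norm_noise_le hX hfs ht ω) (fun t ht => htraj.integral_noise ht)
    (hc₁ B L hB hL1) hc₀.ge
  obtain ⟨hint, hle⟩ := hlse.integral_error_le hTpos hX hmem hfs htraj hGi hG
  refine ⟨hint, ?_⟩
  have hfin := error_bound_le (n₀ := n₀) hB hC hL hL1 hd hTpos hspos rfl rfl hR
    (hlog.trans (by rw [hs2])) hc₀nn hs1 hsC hs0
  rw [← hRs]
  have hσ := Real.sqrt_nonneg (σ ^ 2 / T * (d : ℝ) ^ 2 *
    Real.log (1 + 2 * σ * Real.sqrt d * B * C * (T : ℝ) ^ 2))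
  linarith [hle.trans (hGb.trans hfin)]
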